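/- Let $N\ge 2$ and let $\Omega\subset\mathbb{R}^N$ be a bounded domain (nonempty, open, connected). Write $d_\Omega(x)=\operatorname{dist}(x,\partial\Omega)$, let $\|\cdot\|_r$ be the norm of $L^r(\Omega)$, and let $C_0(\overline\Omega)$ be the set of continuous functions on $\overline\Omega$ that vanish on $\partial\Omega$. For $p>N$ and $1\le q<\infty$ put $$\lambda_{p,q}:=\inf\Big\{\int_\Omega|\nabla u|^p\,dx : u\in W_0^{1,p}(\Omega),\ \int_\Omega|u|^q\,dx=1\Big\},$$ and put $$\Lambda_\infty:=\inf\big\{\|\nabla u\|_\infty : u\in C_0(\overline\Omega)\cap W^{1,\infty}(\Omega),\ \|u\|_\infty=1\big\}.$$ Let $q(p)\in[1,\infty)$ be given for every real $p>N$, with $q(p)\to\infty$ as $p\to\infty$. Then $$\Lambda_\infty=\|d_\Omega\|_\infty^{-1}\qquad\text{and}\qquad \lim_{p\to\infty}\lambda_{p,q(p)}^{1/p}=\Lambda_\infty .$$ Moreover, for each $p>N$ let $u_{p,q(p)}\in W_0^{1,p}(\Omega)$ (represented by a function continuous on $\overline\Omega$) be any minimizer for $\lambda_{p,q(p)}$ that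 is positive in $\Omega$. Then $\lim_{p\to\infty}\|u_{p,q(p)}\|_\infty=1$, and for every sequence $p_n\to\infty$ the sequence $u_{p_n,q(p_n)}$ has a subsequence that converges uniformly on $\overline\Omega$ to a function $u_\infty\in C_0(\overline\Omega)\cap W^{1,\infty}(\Omega)$ with the following properties. 1. $0\le u_\infty(x)\le\Lambda_\infty d_\Omega(x)$ for all $x\in\overline\Omega$. 2. $\|u_\infty\|_\infty=1$ and $\|\nabla u_\infty\|_\infty=\Lambda_\infty$. 3. $\{x\in\Omega: u_\infty(x)=1\}\subseteq\{x\in\Omega: d_\Omega(x)=\|d_\Omega\|_\infty\}$. 4. $u_\infty$ is infinity superharmonic in $\Omega$ in the viscosity sense: for every $x_0\in\Omega$, every ball $B\subset\Omega$ centered at $x_0$ and every $\phi\in C^2(B)$ with $\phi(x_0)=u_\infty(x_0)$ and $\phi<u_\infty$ on $B\setminus\{x_0\}$, one has $-\sum_{i,j=1}^N\phi_{x_i}\phi_{x_j}\phi_{x_ix_j}(x_0)\ge 0$. Moreover, $u_\infty>0$ in $\Omega$. -/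

import Mathlib

open Set Filter Topology MeasureTheory
open scoped ContDiff

noncomputable section

namespace SobolevExtremal

/-- The Euclidean space of dimension `N`. -/
abbrev RN (N : ℕ) : Type := EuclideanSpace ℝ (Fin N)

/-- The classical partial derivative in the `i`-th coordinate direction. -/
def pderiv {N : ℕ} (i : Fin N) (f : RN N → ℝ) (x : RN N) : ℝ :=
  fderiv ℝ f x (EuclideanSpace.single i 1)

/-- `φ` is a test function on `Ω`: an element of `C_c^∞(Ω)`, extended by zero. -/
def IsTestFunction {N : ℕ} (Ω : Set (RN N)) (φ : RN N → ℝ) : Prop :=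
  ContDiff ℝ ∞ φ ∧ HasCompactSupport φ ∧ tsupport φ ⊆ Ω

/-- `G` is the weak (distributional) gradient of `u` in `Ω`. -/
def HasWeakGradient {N : ℕ} (Ω : Set (RN N)) (u : RN N → ℝ) (G : RN N → RN N) : Prop :=
  LocallyIntegrableOn u Ω ∧ LocallyIntegrableOn G Ω ∧
    ∀ φ : RN N → ℝ, IsTestFunction Ω φ → ∀ i : Fin N,
      ∫ x in Ω, u x * pderiv i φ x = - ∫ x in Ω, G x i * φ x

/-- `u ∈ W₀^{1,p}(Ω)`, with weak gradient `G`: the function `u` belongs to `W^{1,p}(Ω)`, and it is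
a limit of test functions in the norm of `W^{1,p}(Ω)`. -/
structure MemW0 {N : ℕ} (Ω : Set (RN N)) (p : ℝ) (u : RN N → ℝ) (G : RN N → RN N) : Prop where
  memLp : MemLp u (ENNReal.ofReal p) (volume.restrict Ω)
  hasWeakGradient : HasWeakGradient Ω u G
  memLp_grad : MemLp G (ENNReal.ofReal p) (volume.restrict Ω)
  approx : ∃ φ : ℕ → RN N → ℝ, (∀ k, IsTestFunction Ω (φ k)) ∧
    Tendsto (fun k => eLpNorm (fun x => u x - φ k x) (ENNReal.ofReal p) (volume.restrict Ω))
      atTop (𝓝 0) ∧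
    Tendsto (fun k => eLpNorm (fun x => G x - gradient (φ k) x) (ENNReal.ofReal p)
      (volume.restrict Ω)) atTop (𝓝 0)

/-- `u ∈ W^{1,∞}(Ω)`, with weak gradient `G`. -/
structure MemW1Inf {N : ℕ} (Ω : Set (RN N)) (u : RN N → ℝ) (G : RN N → RN N) : Prop where
  memLp : MemLp u ⊤ (volume.restrict Ω)
  hasWeakGradient : HasWeakGradient Ω u G
  memLp_grad : MemLp G ⊤ (volume.restrict Ω)

/-- `u ∈ C₀(closure Ω)`: `u` is continuous on the closure of `Ω` and vanishes on its boundary. -/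
def MemC0 {N : ℕ} (Ω : Set (RN N)) (u : RN N → ℝ) : Prop :=
  ContinuousOn u (closure Ω) ∧ ∀ x ∈ frontier Ω, u x = 0

/-- The norm of `L^∞(Ω)`. -/
def linfNorm {N : ℕ} {F : Type*} [NormedAddCommGroup F] (Ω : Set (RN N)) (f : RN N → F) : ℝ :=
  (eLpNorm f ⊤ (volume.restrict Ω)).toReal

/-- The distance to the boundary of `Ω`. -/
def bdryDist {N : ℕ} (Ω : Set (RN N)) (x : RN N) : ℝ := Metric.infDist x (frontier Ω)

/-- `λ_{p,q}`, the infimum of `∫_Ω |∇u|^p` over the `u ∈ W₀^{1,p}(Ω)` with `∫_Ω |u|^q = 1`. -/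
def sobolevConst {N : ℕ} (Ω : Set (RN N)) (p q : ℝ) : ℝ :=
  sInf {r : ℝ | ∃ (u : RN N → ℝ) (G : RN N → RN N), MemW0 Ω p u G ∧
    (∫ x in Ω, |u x| ^ q) = 1 ∧ r = ∫ x in Ω, ‖G x‖ ^ p}

/-- `u` is a positive extremal function for `λ_{p,q}`. As `p > N`, elements of `W₀^{1,p}(Ω)` are
identified with their representatives that are continuous on the closure of `Ω`. -/
def IsExtremal {N : ℕ} (Ω : Set (RN N)) (p q : ℝ) (u : RN N → ℝ) : Prop :=
  ContinuousOn u (closure Ω) ∧ (∀ x ∈ Ω, 0 < u x) ∧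
    ∃ G : RN N → RN N, MemW0 Ω p u G ∧ (∫ x in Ω, |u x| ^ q) = 1 ∧
      (∫ x in Ω, ‖G x‖ ^ p) = sobolevConst Ω p q

/-- `Λ_∞`, the infimum of `‖∇u‖_∞` over the `u ∈ C₀(closure Ω) ∩ W^{1,∞}(Ω)` with
`‖u‖_∞ = 1`. -/
def lambdaInf {N : ℕ} (Ω : Set (RN N)) : ℝ :=
  sInf {r : ℝ | ∃ (u : RN N → ℝ) (G : RN N → RN N), MemC0 Ω u ∧ MemW1Inf Ω u G ∧
    linfNorm Ω u = 1 ∧ r = linfNorm Ω G}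

/-- The infinity Laplacian `∑_{i,j} u_{x_i} u_{x_j} u_{x_i x_j}` of a `C²` function. -/
def infLaplacian {N : ℕ} (φ : RN N → ℝ) (x : RN N) : ℝ :=
  ∑ i, ∑ j, pderiv i φ x * pderiv j φ x * pderiv j (pderiv i φ) x

/-- `u` is infinity superharmonic in `D`: it is continuous and satisfies `-Δ_∞ u ≥ 0` in `D` in
the viscosity sense. -/
def IsInfSuperharmonic {N : ℕ} (D : Set (RN N)) (u : RN N → ℝ) : Prop :=
  ContinuousOn u D ∧
    ∀ x₀ ∈ D, ∀ r > 0, Metric.ball x₀ r ⊆ D →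
      ∀ φ : RN N → ℝ, ContDiffOn ℝ 2 φ (Metric.ball x₀ r) → φ x₀ - u x₀ = 0 →
        (∀ x ∈ Metric.ball x₀ r, x ≠ x₀ → φ x - u x < 0) → 0 ≤ - infLaplacian φ x₀

end SobolevExtremal

end

open SobolevExtremal

/-!
The argument is variational throughout; no Euler–Lagrange equation and no weak compactness is used.

*A Morrey estimate that becomes sharp as `p → ∞`.* Comparing `f x` with the average of `f` over a
ball of radius `ε` and using Hölder's inequality on rescaled balls gives
`|f x - f a| ≤ C(p, ε) (|x - a| + 2 ε) ‖∇f‖_p`, where `C(p, ε) → 1` as `p → ∞` for every fixed `ε`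
(`abs_sub_le_morreyConst`, `tendsto_morreyConst`). Hence every element of `W₀^{1,p}`, `p > N`, has a
representative that is continuous on the whole space, vanishes off `Ω` and inherits the estimate
(`MemW0.exists_continuous_rep`). Letting `p → ∞` and then `ε → 0`, a limit of functions with
`‖∇u_p‖_p → Λ` is `Λ`-Lipschitz on the whole space.

*The constants.* Mollification shows that a function in `C₀ ∩ W^{1,∞}` is at most `‖∇u‖_∞ d_Ω`, so
that the scaled distance function is optimal for `Λ_∞` (`lambdaInf_eq`). The Morrey estimate, applied
between a point and a nearest boundary point, bounds the Sobolev constants from below; mollified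
truncations of the distance function bound them from above (`tendsto_sobolevConst_rpow`). The same
estimates give `‖u_p‖_∞ → 1`.

*Infinity superharmonicity.* If a smooth strictly `p`-subharmonic `ψ` exceeded a minimizer `u`
somewhere in a ball but not near its boundary, then replacing `u` by `u + F(ψ - u)`, with `F` a smooth
substitute for the positive part, would lower the `p`-energy by convexity and increase the `L^q` norm,
against minimality (`false_of_touching_below`). With test functions approximating `u` in place of `u`,
only smooth functions are differentiated. A quadratic polynomial with positive infinity Laplacian is
strictly `p`-subharmonic near the contact point for large `p`, so the uniform limit is infinity
superharmonic when tested with quadratic polynomials (`isQuadSuper_of_tendstoUniformly`); Taylor's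
formula passes to `C²` test functions (`IsQuadSuper.isInfSuperharmonic`).

*Positivity.* The functions `κ |x - y|⁻²` are strictly infinity subharmonic off `y`. Comparison with
them on annuli propagates positivity of the limit from a point to a ball, and hence to the connected
set `Ω` (`IsQuadSuper.pos`).
-/

namespace SobolevExtremal

/-! ### A Morrey estimate with explicit constants -/

lemma enorm_sub_le_lintegral_gradient {N : ℕ} {f : RN N → ℝ} (hf : ContDiff ℝ 1 f) (x z : RN N) :
    ‖f (x + z) - f x‖ₑ ≤ ∫⁻ t in Ioc (0 : ℝ) 1, ‖z‖ₑ * ‖gradient f (x + t • z)‖ₑ := by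
  have hd : ∀ t : ℝ, HasDerivAt (fun t : ℝ => f (x + t • z)) (fderiv ℝ f (x + t • z) z) t := by
    intro t
    have h1 : HasDerivAt (fun t : ℝ => x + t • z) z t := by
      simpa using ((hasDerivAt_id t).smul_const z).const_add x
    exact ((hf.differentiable (by simp)) (x + t • z)).hasFDerivAt.comp_hasDerivAt t h1
  have hcont : Continuous fun t : ℝ => fderiv ℝ f (x + t • z) z :=
    ((hf.continuous_fderiv (by simp)).comp (by fun_prop)).clm_apply continuous_const
  have h := intervalIntegral.integral_eq_sub_of_hasDerivAt (a := 0) (b := 1)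
    (fun t _ => hd t) (hcont.intervalIntegrable _ _)
  simp only [one_smul, zero_smul, add_zero] at h
  rw [← h, intervalIntegral.integral_of_le zero_le_one]
  refine (enorm_integral_le_lintegral_enorm _).trans (lintegral_mono fun t => ?_)
  have : ‖fderiv ℝ f (x + t • z) z‖ ≤ ‖z‖ * ‖gradient f (x + t • z)‖ := by
    rw [gradient, LinearIsometryEquiv.norm_map, mul_comm]
    exact ContinuousLinearMap.le_opNorm _ _
  rw [← ofReal_norm, ← ofReal_norm, ← ofReal_norm,
    ← ENNReal.ofReal_mul (norm_nonneg _)]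
  exact ENNReal.ofReal_le_ofReal this

lemma continuous_gradient {N : ℕ} {f : RN N → ℝ} (hf : ContDiff ℝ 1 f) :
    Continuous (gradient f) :=
  (InnerProductSpace.toDual ℝ (RN N)).symm.continuous.comp (hf.continuous_fderiv (by simp))

/-- The change of variables `y ↦ c + t y` scales the `L^p` norm by `t^{-N/p}`; this exponent is what
makes the estimate below integrable in `t` exactly when `p > N`. -/
lemma eLpNorm_comp_add_smul {N : ℕ} {F : Type*} [NormedAddCommGroup F] {g : RN N → F}
    (hg : Continuous g) {p : ℝ} (hp : 0 < p) (c : RN N) {t : ℝ} (ht : 0 < t) :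
    eLpNorm (fun y => g (c + t • y)) (ENNReal.ofReal p) volume =
      ENNReal.ofReal (t ^ (-(N / p) : ℝ)) * eLpNorm g (ENNReal.ofReal p) volume := by
  have h1 : eLpNorm (fun y => g (c + y)) (ENNReal.ofReal p) volume
      = eLpNorm g (ENNReal.ofReal p) volume :=
    eLpNorm_comp_measurePreserving hg.aestronglyMeasurable (measurePreserving_add_left volume c)
  have hgc : Continuous fun y => g (c + y) := by fun_prop
  have h2 := eLpNorm_map_measure (μ := (volume : Measure (RN N))) (p := ENNReal.ofReal p)
    (f := fun x : RN N => t • x) (g := fun y => g (c + y)) hgc.aestronglyMeasurable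
    (by fun_prop)
  rw [Measure.map_addHaar_smul _ ht.ne', eLpNorm_smul_measure_of_ne_top (by simp), h1] at h2
  change _ = eLpNorm (fun y => g (c + t • y)) (ENNReal.ofReal p) volume at h2
  rw [← h2, smul_eq_mul]
  congr 1
  have hpr : (1 / ENNReal.ofReal p).toReal = 1 / p := by
    rw [ENNReal.toReal_div, ENNReal.toReal_ofReal hp.le]; simp
  rw [hpr, finrank_euclideanSpace_fin, abs_of_pos (by positivity),
    ENNReal.ofReal_rpow_of_pos (by positivity)]
  congr 1
  rw [← Real.rpow_natCast, ← Real.rpow_neg ht.le, ← Real.rpow_mul ht.le]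
  congr 1
  ring

lemma lintegral_rpow_neg {a : ℝ} (ha : a < 1) :
    ∫⁻ t in Ioc (0 : ℝ) 1, ENNReal.ofReal (t ^ (-a)) = ENNReal.ofReal (1 / (1 - a)) := by
  have hi : IntervalIntegrable (fun t : ℝ => t ^ (-a)) volume 0 1 :=
    intervalIntegral.intervalIntegrable_rpow' (by linarith)
  rw [← ofReal_integral_eq_lintegral_ofReal, ← intervalIntegral.integral_of_le zero_le_one,
    integral_rpow (Or.inl (by linarith))]
  · rw [Real.one_rpow, Real.zero_rpow (by linarith)]
    congr 2 <;> ring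
  · exact (intervalIntegrable_iff_integrableOn_Ioc_of_le zero_le_one).1 hi
  · filter_upwards [ae_restrict_mem measurableSet_Ioc] with t ht
    exact Real.rpow_nonneg ht.1.le _

/-- The difference between `f x` and `f` on the ball of radius `ε` around `a`, integrated over that ball.
The segments from `x` to `a + y` are at time `t` at the points `x + t (a - x) + t y`, which fill a
ball of radius `t ε`, so that Hölder's inequality applies at each time. -/
lemma lintegral_ball_enorm_sub_le {N : ℕ} {f : RN N → ℝ} (hf : ContDiff ℝ 1 f) {p : ℝ}
    (hp : (N : ℝ) < p) (hp1 : 1 ≤ p) (x a : RN N) (ε : ℝ) :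
    ∫⁻ y in Metric.ball (0 : RN N) ε, ‖f (a + y) - f x‖ₑ ≤
      ENNReal.ofReal ((dist x a + ε) / (1 - N / p)) *
        volume (Metric.ball (0 : RN N) ε) ^ (1 - 1 / p) *
          eLpNorm (gradient f) (ENNReal.ofReal p) volume := by
  have hp0 : 0 < p := by linarith
  set B := Metric.ball (0 : RN N) ε with hB
  set K := eLpNorm (gradient f) (ENNReal.ofReal p) volume with hK
  set V := volume B with hV
  have hgc := continuous_gradient hf
  have hNp : (N : ℝ) / p < 1 := by rwa [div_lt_one hp0]
  have hone : (1 : ENNReal) ≤ ENNReal.ofReal p := by simpa using hp1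
  calc ∫⁻ y in B, ‖f (a + y) - f x‖ₑ
      ≤ ∫⁻ y in B, ∫⁻ t in Ioc (0 : ℝ) 1, ENNReal.ofReal (dist x a + ε) *
          ‖gradient f ((x + t • (a - x)) + t • y)‖ₑ := by
        refine setLIntegral_mono' measurableSet_ball fun y hy => ?_
        have h := enorm_sub_le_lintegral_gradient hf x (a - x + y)
        rw [show x + (a - x + y) = a + y by abel] at h
        refine h.trans (lintegral_mono fun t => ?_)
        rw [show x + t • (a - x + y) = (x + t • (a - x)) + t • y by rw [smul_add]; abel]
        gcongr
        rw [← ofReal_norm]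
        refine ENNReal.ofReal_le_ofReal ((norm_add_le _ _).trans ?_)
        have : ‖y‖ < ε := by simpa [hB] using hy
        rw [dist_comm, dist_eq_norm]
        linarith
    _ = ∫⁻ t in Ioc (0 : ℝ) 1, ENNReal.ofReal (dist x a + ε) *
          ∫⁻ y in B, ‖gradient f ((x + t • (a - x)) + t • y)‖ₑ := by
        rw [lintegral_lintegral_swap]
        · refine lintegral_congr fun t => ?_
          rw [lintegral_const_mul]
          exact (Continuous.measurable (by fun_prop))
        · have : Continuous fun z : RN N × ℝ => gradient f ((x + z.2 • (a - x)) + z.2 • z.1) := by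
            fun_prop
          exact this.enorm.measurable.aemeasurable.const_mul _
    _ ≤ ∫⁻ t in Ioc (0 : ℝ) 1, ENNReal.ofReal (dist x a + ε) *
          (ENNReal.ofReal (t ^ (-(N / p) : ℝ)) * K * V ^ (1 - 1 / p)) := by
        refine setLIntegral_mono' measurableSet_Ioc fun t ht => ?_
        gcongr
        have h1 : ∫⁻ y in B, ‖gradient f ((x + t • (a - x)) + t • y)‖ₑ =
            eLpNorm (fun y => gradient f ((x + t • (a - x)) + t • y)) 1 (volume.restrict B) := by
          rw [eLpNorm_one_eq_lintegral_enorm]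
        rw [h1]
        refine (eLpNorm_le_eLpNorm_mul_rpow_measure_univ hone
          (Continuous.aestronglyMeasurable (by fun_prop))).trans ?_
        rw [Measure.restrict_apply_univ, ENNReal.toReal_ofReal hp0.le, ENNReal.toReal_one, div_one]
        gcongr
        rw [← eLpNorm_comp_add_smul hgc hp0 _ ht.1]
        exact eLpNorm_mono_measure _ Measure.restrict_le_self
    _ = _ := by
        have : ∀ t : ℝ, ENNReal.ofReal (dist x a + ε) *
          (ENNReal.ofReal (t ^ (-(N / p) : ℝ)) * K * V ^ (1 - 1 / p)) =
          (ENNReal.ofReal (dist x a + ε) * K * V ^ (1 - 1 / p)) *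
            ENNReal.ofReal (t ^ (-(N / p) : ℝ)) := fun t => by ring
        simp_rw [this]
        rw [lintegral_const_mul _ (by fun_prop), lintegral_rpow_neg hNp,
          div_eq_mul_one_div (dist x a + ε), ENNReal.ofReal_mul' (by
            have : 0 < 1 - (N : ℝ) / p := by linarith
            positivity)]
        ring

/-- The constant `|B_ε|^{-1/p} / (1 - N/p)` of the Morrey estimate at scale `ε`; it tends to `1` as
`p → ∞`, for every fixed `ε`. -/
noncomputable def morreyConst (N : ℕ) (p ε : ℝ) : ℝ :=
  (volume (Metric.ball (0 : RN N) ε)).toReal ^ (-(1 / p)) / (1 - N / p)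

lemma ball_volume_pos {N : ℕ} {ε : ℝ} (hε : 0 < ε) :
    0 < (volume (Metric.ball (0 : RN N) ε)).toReal :=
  ENNReal.toReal_pos (Metric.measure_ball_pos _ _ hε).ne' measure_ball_lt_top.ne

lemma morreyConst_pos {N : ℕ} {p ε : ℝ} (hp : (N : ℝ) < p) (hε : 0 < ε) :
    0 < morreyConst N p ε := by
  have hNp : (N : ℝ) / p < 1 := by rwa [div_lt_one (N.cast_nonneg.trans_lt hp)]
  exact div_pos (Real.rpow_pos_of_pos (ball_volume_pos hε) _) (by linarith)

lemma tendsto_morreyConst (N : ℕ) {ε : ℝ} (hε : 0 < ε) :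
    Tendsto (fun p => morreyConst N p ε) atTop (𝓝 1) := by
  have h1 : Tendsto (fun p : ℝ => -(1 / p)) atTop (𝓝 0) := by
    simpa using (tendsto_inv_atTop_zero (𝕜 := ℝ)).neg
  have h2 : Tendsto (fun p : ℝ => 1 - (N : ℝ) / p) atTop (𝓝 (1 - 0)) :=
    tendsto_const_nhds.sub (tendsto_const_nhds.div_atTop tendsto_id)
  have h3 := (tendsto_const_nhds (x := (volume (Metric.ball (0 : RN N) ε)).toReal)).rpow h1
    (Or.inl (ball_volume_pos hε).ne')
  have h4 := h3.div h2 (by norm_num)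
  rw [Real.rpow_zero, sub_zero, div_one] at h4
  exact h4

/-- The Morrey estimate at scale `ε`. The Hölder exponent is traded for the free parameter `ε`, which
allows passing to the limit `p → ∞` with the sharp constant. -/
theorem abs_sub_le_morreyConst {N : ℕ} {f : RN N → ℝ} (hf : ContDiff ℝ 1 f) {p : ℝ}
    (hp : (N : ℝ) < p) (hp1 : 1 ≤ p) (hfp : MemLp (gradient f) (ENNReal.ofReal p) volume)
    (x a : RN N) {ε : ℝ} (hε : 0 < ε) :
    |f x - f a| ≤ morreyConst N p ε * (dist x a + 2 * ε) *
      (eLpNorm (gradient f) (ENNReal.ofReal p) volume).toReal := by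
  have hp0 : 0 < p := by linarith
  have hNp : 0 < 1 - (N : ℝ) / p := by
    have : (N : ℝ) / p < 1 := by rwa [div_lt_one hp0]
    linarith
  set B := Metric.ball (0 : RN N) ε with hB
  set K := eLpNorm (gradient f) (ENNReal.ofReal p) volume with hK
  set V := volume B with hV
  have hVt : V ≠ ⊤ := measure_ball_lt_top.ne
  have hV0 : 0 < V.toReal := ball_volume_pos hε
  have h1 := lintegral_ball_enorm_sub_le hf hp hp1 x a ε
  have h2 := lintegral_ball_enorm_sub_le hf hp hp1 a a ε
  have hfc := hf.continuous
  have h3 : ‖f x - f a‖ₑ * V ≤ ENNReal.ofReal ((dist x a + ε) / (1 - N / p)) * V ^ (1 - 1 / p) * K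
      + ENNReal.ofReal ((dist a a + ε) / (1 - N / p)) * V ^ (1 - 1 / p) * K := by
    refine le_trans ?_ (add_le_add h1 h2)
    rw [← setLIntegral_const, ← lintegral_add_left (Continuous.measurable (by fun_prop))]
    refine lintegral_mono fun y => ?_
    have : f x - f a = (f (a + y) - f a) - (f (a + y) - f x) := by ring
    rw [this]
    exact enorm_sub_le.trans (add_comm _ _).le
  have hd : 0 ≤ (dist x a + ε) / (1 - N / p) := by positivity
  have hd' : 0 ≤ (0 + ε) / (1 - N / p) := by positivity
  have hVp : V ^ (1 - 1 / p) ≠ ⊤ := by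
    refine ENNReal.rpow_ne_top_of_nonneg ?_ hVt
    rw [sub_nonneg, div_le_one hp0]; exact hp1
  have hKt : K ≠ ⊤ := hfp.2.ne
  have h4 := ENNReal.toReal_mono (by finiteness) h3
  rw [ENNReal.toReal_add (by finiteness) (by finiteness)] at h4
  simp only [dist_self, ENNReal.toReal_mul, ENNReal.toReal_ofReal hd, ENNReal.toReal_ofReal hd',
    ← ENNReal.toReal_rpow, toReal_enorm, Real.norm_eq_abs] at h4
  have hVs : V.toReal ^ (1 - 1 / p) = V.toReal * V.toReal ^ (-(1 / p)) := by
    rw [sub_eq_add_neg, Real.rpow_add hV0, Real.rpow_one]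
  rw [hVs] at h4
  refine le_of_mul_le_mul_right (h4.trans (le_of_eq ?_)) hV0
  rw [morreyConst, ← hB, ← hV]
  generalize V.toReal ^ (-(1 / p)) = W
  ring

/-! ### Continuous representatives of `W₀^{1,p}` functions -/

section
variable {N : ℕ} {Ω : Set (RN N)} {p : ℝ}

lemma IsTestFunction.contDiff_one {φ : RN N → ℝ} (h : IsTestFunction Ω φ) : ContDiff ℝ 1 φ :=
  h.1.of_le (by exact_mod_cast le_top)

lemma IsTestFunction.eq_zero {φ : RN N → ℝ} (h : IsTestFunction Ω φ) {x : RN N} (hx : x ∉ Ω) :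
    φ x = 0 :=
  image_eq_zero_of_notMem_tsupport fun hx' => hx (h.2.2 hx')

lemma gradient_eq_zero_of_notMem_tsupport {φ : RN N → ℝ} {x : RN N} (hx : x ∉ tsupport φ) :
    gradient φ x = 0 := by
  have : fderiv ℝ φ x = 0 := image_eq_zero_of_notMem_tsupport fun hx' =>
    hx (tsupport_fderiv_subset ℝ hx')
  rw [gradient, this, map_zero]

lemma IsTestFunction.gradient_eq_zero {φ : RN N → ℝ} (h : IsTestFunction Ω φ) {x : RN N}
    (hx : x ∉ Ω) : gradient φ x = 0 :=
  gradient_eq_zero_of_notMem_tsupport fun hx' => hx (h.2.2 hx')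

lemma IsTestFunction.hasCompactSupport_gradient {φ : RN N → ℝ} (h : IsTestFunction Ω φ) :
    HasCompactSupport (gradient φ) :=
  h.2.1.mono' fun x hx => by
    by_contra hx'
    exact hx (gradient_eq_zero_of_notMem_tsupport hx')

lemma IsTestFunction.memLp_gradient {φ : RN N → ℝ} (h : IsTestFunction Ω φ) (p : ENNReal) :
    MemLp (gradient φ) p volume :=
  (continuous_gradient h.contDiff_one).memLp_of_hasCompactSupport h.hasCompactSupport_gradient

lemma IsTestFunction.sub {φ ψ : RN N → ℝ} (h : IsTestFunction Ω φ) (h' : IsTestFunction Ω ψ) :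
    IsTestFunction Ω (φ - ψ) :=
  ⟨h.1.sub h'.1, h.2.1.sub h'.2.1,
    (tsupport_sub φ ψ).trans (union_subset h.2.2 h'.2.2)⟩

lemma IsTestFunction.add {φ ψ : RN N → ℝ} (h : IsTestFunction Ω φ) (h' : IsTestFunction Ω ψ) :
    IsTestFunction Ω (φ + ψ) :=
  ⟨h.1.add h'.1, h.2.1.add h'.2.1,
    (tsupport_add φ ψ).trans (union_subset h.2.2 h'.2.2)⟩

lemma IsTestFunction.const_mul {φ : RN N → ℝ} (h : IsTestFunction Ω φ) (c : ℝ) :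
    IsTestFunction Ω (fun x => c * φ x) :=
  ⟨contDiff_const.mul h.1, h.2.1.mul_left,
    (tsupport_mul_subset_right (f := fun _ => c)).trans h.2.2⟩

lemma gradient_sub_apply {φ ψ : RN N → ℝ} {x : RN N} (h : DifferentiableAt ℝ φ x)
    (h' : DifferentiableAt ℝ ψ x) :
    gradient (φ - ψ) x = gradient φ x - gradient ψ x := by
  simp only [gradient, fderiv_sub h h', map_sub]

lemma IsTestFunction.differentiable {φ : RN N → ℝ} (h : IsTestFunction Ω φ) :
    Differentiable ℝ φ := h.1.differentiable (by simp)

lemma IsTestFunction.eLpNorm_gradient {φ : RN N → ℝ} (h : IsTestFunction Ω φ) (p : ENNReal) :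
    eLpNorm (gradient φ) p volume = eLpNorm (gradient φ) p (volume.restrict Ω) :=
  (eLpNorm_restrict_eq_of_support_subset fun x hx => by
    by_contra hx'
    exact hx (h.gradient_eq_zero hx')).symm

lemma toReal_eLpNorm_eq {F : Type*} [NormedAddCommGroup F] {G : RN N → F} (hp : 0 < p)
    (hG : MemLp G (ENNReal.ofReal p) (volume.restrict Ω)) :
    (eLpNorm G (ENNReal.ofReal p) (volume.restrict Ω)).toReal
      = (∫ x in Ω, ‖G x‖ ^ p) ^ (1 / p) := by
  rw [hG.eLpNorm_eq_integral_rpow_norm (by simpa using hp) (by simp),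
    ENNReal.toReal_ofReal (by positivity), ENNReal.toReal_ofReal hp.le, one_div]

lemma integral_norm_rpow_eq {F : Type*} [NormedAddCommGroup F] {G : RN N → F} (hp : 0 < p)
    (hG : MemLp G (ENNReal.ofReal p) (volume.restrict Ω)) :
    ∫ x in Ω, ‖G x‖ ^ p =
      (eLpNorm G (ENNReal.ofReal p) (volume.restrict Ω)).toReal ^ p := by
  rw [toReal_eLpNorm_eq hp hG, ← Real.rpow_mul (by positivity), one_div,
    inv_mul_cancel₀ hp.ne', Real.rpow_one]

/-- The Morrey estimate bounds a test function uniformly by the `L^p` norm of its gradient, as it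
vanishes at any point `z` outside `Ω`. -/
lemma IsTestFunction.abs_le {φ : RN N → ℝ} (h : IsTestFunction Ω φ) (hp : (N : ℝ) < p)
    (hp1 : 1 ≤ p) {z : RN N} (hz : z ∉ Ω) {M : ℝ} (hM : ∀ x ∈ Ω, dist x z ≤ M) (x : RN N) :
    |φ x| ≤ morreyConst N p 1 * (|M| + 2) *
      (eLpNorm (gradient φ) (ENNReal.ofReal p) (volume.restrict Ω)).toReal := by
  have hC := morreyConst_pos hp one_pos
  by_cases hx : x ∈ Ω
  · have := abs_sub_le_morreyConst h.contDiff_one hp hp1 (h.memLp_gradient _) x z one_pos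
    rw [h.eq_zero hz, sub_zero, h.eLpNorm_gradient] at this
    refine this.trans ?_
    have := (hM x hx).trans (le_abs_self M)
    gcongr
    linarith
  · rw [h.eq_zero hx, abs_zero]
    positivity

/-- Every element of `W₀^{1,p}(Ω)`, `p > N`, has a representative that is continuous on the whole
space, vanishes off `Ω`, and is a uniform limit of test functions whose gradients converge in
`L^p`. -/
theorem MemW0.exists_continuous_rep {u : RN N → ℝ} {G : RN N → RN N} (h : MemW0 Ω p u G)
    (hΩb : Bornology.IsBounded Ω) (hp : (N : ℝ) < p) (hp1 : 1 ≤ p) (hne : ∃ z, z ∉ Ω) :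
    ∃ (v : RN N → ℝ) (φ : ℕ → RN N → ℝ), (∀ k, IsTestFunction Ω (φ k)) ∧
      TendstoUniformly φ v atTop ∧ Continuous v ∧ (∀ x ∉ Ω, v x = 0) ∧
      v =ᵐ[volume.restrict Ω] u ∧
      Tendsto (fun k => ∫ x in Ω, ‖gradient (φ k) x‖ ^ p) atTop (𝓝 (∫ x in Ω, ‖G x‖ ^ p)) := by
  obtain ⟨z, hz⟩ := hne
  have hp0 : 0 < p := by linarith
  have hone : (1 : ENNReal) ≤ ENNReal.ofReal p := by simpa using hp1
  obtain ⟨φ, hφ, hu, hG⟩ := h.approx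
  obtain ⟨M, hM⟩ := hΩb.subset_closedBall z
  replace hM : ∀ x ∈ Ω, dist x z ≤ M := fun x hx => hM hx
  set μ := volume.restrict Ω with hμ
  set P := ENNReal.ofReal p with hP
  have hgL : ∀ k, MemLp (gradient (φ k)) P μ := fun k => ((hφ k).memLp_gradient _).restrict _
  have hdL : ∀ k, MemLp (fun x => G x - gradient (φ k) x) P μ := fun k => h.memLp_grad.sub (hgL k)
  set a : ℕ → ℝ := fun k => (eLpNorm (fun x => G x - gradient (φ k) x) P μ).toReal with ha
  have ha0 : Tendsto a atTop (𝓝 0) := by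
    have := (ENNReal.tendsto_toReal ENNReal.zero_ne_top).comp hG
    rwa [ENNReal.toReal_zero] at this
  set C := morreyConst N p 1 * (|M| + 2) with hC
  have hCpos : 0 < C := by
    have := morreyConst_pos hp one_pos
    positivity
  have hkl : ∀ k l x, |φ k x - φ l x| ≤ C * (a k + a l) := by
    intro k l x
    refine (((hφ k).sub (hφ l)).abs_le hp hp1 hz hM x).trans ?_
    gcongr
    rw [← ENNReal.toReal_add (hdL k).2.ne (hdL l).2.ne]
    refine ENNReal.toReal_mono (ENNReal.add_ne_top.2 ⟨(hdL k).2.ne, (hdL l).2.ne⟩) ?_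
    rw [add_comm]
    refine le_trans (le_of_eq ?_) (eLpNorm_sub_le (hdL l).1 (hdL k).1 hone)
    congr 1
    ext1 x
    rw [gradient_sub_apply ((hφ k).differentiable x) ((hφ l).differentiable x)]
    simp
  have hcau : ∀ x, CauchySeq fun k => φ k x := by
    intro x
    rw [Metric.cauchySeq_iff]
    intro ε hε
    have : ∀ᶠ k in atTop, a k < ε / (2 * C) := ha0.eventually (gt_mem_nhds (by positivity))
    obtain ⟨n, hn⟩ := eventually_atTop.1 this
    refine ⟨n, fun k hk l hl => ?_⟩
    rw [Real.dist_eq]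
    refine (hkl k l x).trans_lt ?_
    calc C * (a k + a l) < C * (ε / (2 * C) + ε / (2 * C)) :=
          mul_lt_mul_of_pos_left (add_lt_add (hn k hk) (hn l hl)) hCpos
      _ = ε := by field_simp; ring
  choose v hv using fun x => cauchySeq_tendsto_of_complete (hcau x)
  have hvφ : ∀ k x, |φ k x - v x| ≤ C * a k := by
    intro k x
    have h1 : Tendsto (fun l => |φ k x - φ l x|) atTop (𝓝 |φ k x - v x|) :=
      (tendsto_const_nhds.sub (hv x)).abs
    have h2 : Tendsto (fun l => C * (a k + a l)) atTop (𝓝 (C * (a k + 0))) :=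
      (tendsto_const_nhds.add ha0).const_mul _
    simpa using le_of_tendsto_of_tendsto' h1 h2 fun l => hkl k l x
  have hunif : TendstoUniformly φ v atTop := by
    rw [Metric.tendstoUniformly_iff]
    intro ε hε
    have : ∀ᶠ k in atTop, C * a k < ε := by
      have h2 : Tendsto (fun k => C * a k) atTop (𝓝 (C * 0)) := ha0.const_mul _
      exact h2.eventually (gt_mem_nhds (by simpa using hε))
    filter_upwards [this] with k hk x
    rw [dist_comm, Real.dist_eq]
    exact (hvφ k x).trans_lt hk
  refine ⟨v, φ, hφ, hunif, hunif.continuous (Frequently.of_forall fun k => (hφ k).1.continuous),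
    fun x hx => ?_, ?_, ?_⟩
  · refine tendsto_nhds_unique (hv x) ?_
    simp [fun k => (hφ k).eq_zero hx]
  · have hm : TendstoInMeasure μ φ atTop u := by
      refine tendstoInMeasure_of_tendsto_eLpNorm (p := P) (by simpa [P] using hp0)
        (fun k => (hφ k).1.continuous.aestronglyMeasurable) h.memLp.1 ?_
      refine hu.congr fun k => ?_
      rw [← eLpNorm_neg]
      congr 1
      ext x
      simp
    obtain ⟨ns, hns, hae⟩ := hm.exists_seq_tendsto_ae
    filter_upwards [hae] with x hx
    exact tendsto_nhds_unique ((hv x).comp hns.tendsto_atTop) hx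
  · rw [integral_norm_rpow_eq hp0 h.memLp_grad]
    refine Tendsto.congr (fun k => (integral_norm_rpow_eq hp0 (hgL k)).symm) ?_
    refine Tendsto.rpow_const ?_ (Or.inr hp0.le)
    rw [tendsto_iff_dist_tendsto_zero]
    refine squeeze_zero (fun _ => dist_nonneg) (fun k => ?_) ha0
    rw [Real.dist_eq, abs_sub_le_iff]
    constructor
    · rw [sub_le_iff_le_add, ← ENNReal.toReal_add (hdL k).2.ne h.memLp_grad.2.ne]
      refine ENNReal.toReal_mono (ENNReal.add_ne_top.2 ⟨(hdL k).2.ne, h.memLp_grad.2.ne⟩) ?_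
      rw [add_comm]
      refine le_trans (le_of_eq ?_) (eLpNorm_sub_le h.memLp_grad.1 (hdL k).1 hone)
      congr 1
      ext1 x
      simp
    · rw [sub_le_iff_le_add, ← ENNReal.toReal_add (hdL k).2.ne (hgL k).2.ne]
      refine ENNReal.toReal_mono (ENNReal.add_ne_top.2 ⟨(hdL k).2.ne, (hgL k).2.ne⟩) ?_
      refine le_trans (le_of_eq ?_) (eLpNorm_add_le (hdL k).1 (hgL k).1 hone)
      congr 1
      ext1 x
      simp

/-- The Morrey estimate passes to uniform limits of test functions. -/
lemma abs_sub_le_of_tendstoUniformly {v : RN N → ℝ} {φ : ℕ → RN N → ℝ}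
    (hφ : ∀ k, IsTestFunction Ω (φ k)) (hv : TendstoUniformly φ v atTop) (hp : (N : ℝ) < p)
    (hp1 : 1 ≤ p) {I : ℝ}
    (hI : Tendsto (fun k => ∫ x in Ω, ‖gradient (φ k) x‖ ^ p) atTop (𝓝 I))
    {ε : ℝ} (hε : 0 < ε) (x a : RN N) :
    |v x - v a| ≤ morreyConst N p ε * (dist x a + 2 * ε) * I ^ (1 / p) := by
  have hp0 : 0 < p := by linarith
  have h1 : Tendsto (fun k => |φ k x - φ k a|) atTop (𝓝 |v x - v a|) :=
    ((hv.tendsto_at x).sub (hv.tendsto_at a)).abs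
  refine le_of_tendsto_of_tendsto' h1
    ((hI.rpow_const (p := 1 / p) (Or.inr (by positivity))).const_mul _) fun k => ?_
  rw [← toReal_eLpNorm_eq hp0 (((hφ k).memLp_gradient _).restrict _), ← (hφ k).eLpNorm_gradient]
  exact abs_sub_le_morreyConst (hφ k).contDiff_one hp hp1 ((hφ k).memLp_gradient _) x a hε

end

/-! ### The supremum norm and the distance to the boundary -/

section
variable {N : ℕ} {Ω : Set (RN N)}

lemma linfNorm_le {F : Type*} [NormedAddCommGroup F] {f : RN N → F} (hΩ : MeasurableSet Ω) {M : ℝ}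
    (hM : 0 ≤ M) (h : ∀ x ∈ Ω, ‖f x‖ ≤ M) : linfNorm Ω f ≤ M := by
  refine ENNReal.toReal_le_of_le_ofReal hM ?_
  rw [eLpNorm_exponent_top]
  refine eLpNormEssSup_le_of_ae_bound ?_
  filter_upwards [ae_restrict_mem hΩ] with x hx using h x hx

lemma ae_norm_le_linfNorm {F : Type*} [NormedAddCommGroup F] {f : RN N → F}
    (h : MemLp f ⊤ (volume.restrict Ω)) : ∀ᵐ x ∂(volume.restrict Ω), ‖f x‖ ≤ linfNorm Ω f := by
  have h1 := h.2
  filter_upwards [ae_le_eLpNormEssSup (f := f) (μ := volume.restrict Ω)] with x hx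
  rw [← eLpNorm_exponent_top] at hx
  have := ENNReal.toReal_mono h1.ne hx
  rwa [toReal_enorm] at this

/-- For a continuous function the essential supremum bounds every value. The bound `M` only ensures
that `linfNorm` is not the junk value of an infinite norm. -/
lemma norm_le_linfNorm {F : Type*} [NormedAddCommGroup F] {f : RN N → F} (hΩ : IsOpen Ω)
    (hf : ContinuousOn f Ω) {M : ℝ} (h : ∀ x ∈ Ω, ‖f x‖ ≤ M) {x : RN N} (hx : x ∈ Ω) :
    ‖f x‖ ≤ linfNorm Ω f := by
  by_contra! hlt
  have hL : MemLp f ⊤ (volume.restrict Ω) :=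
    memLp_top_of_bound (hf.aestronglyMeasurable hΩ.measurableSet) M (by
      filter_upwards [ae_restrict_mem hΩ.measurableSet] with x hx using h x hx)
  have hopen : IsOpen (Ω ∩ (fun x => ‖f x‖) ⁻¹' Ioi (linfNorm Ω f)) :=
    hf.norm.isOpen_inter_preimage hΩ isOpen_Ioi
  have h0 := ae_norm_le_linfNorm hL
  rw [ae_restrict_iff' hΩ.measurableSet] at h0
  refine (hopen.measure_pos volume ⟨x, hx, hlt⟩).ne' (measure_mono_null ?_ h0)
  intro y hy hy'
  exact absurd (hy' hy.1) (not_le.2 hy.2)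

lemma ne_univ_of_isBounded (hN : 1 ≤ N) (hΩb : Bornology.IsBounded Ω) : Ω ≠ univ := by
  rintro rfl
  have : Nonempty (Fin N) := ⟨⟨0, hN⟩⟩
  exact NormedSpace.unbounded_univ ℝ (RN N) hΩb

/-- On `closure Ω` the distance to the boundary is the distance to the complement, which, unlike
`bdryDist`, also vanishes off `Ω`. -/
lemma infDist_compl_eq_bdryDist (hΩ : IsOpen Ω) (hne : Ω ≠ univ) {x : RN N}
    (hx : x ∈ closure Ω) : Metric.infDist x Ωᶜ = bdryDist Ω x := by
  have hsub : frontier Ω ⊆ Ωᶜ := by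
    rw [hΩ.frontier_eq]; exact fun y hy => hy.2
  by_cases hxΩ : x ∈ Ω
  · obtain ⟨y, hy, hxy⟩ := exists_mem_frontier_infDist_compl_eq_dist hxΩ hne
    refine le_antisymm (Metric.infDist_le_infDist_of_subset hsub ⟨y, hy⟩) ?_
    rw [hxy]
    exact Metric.infDist_le_dist_of_mem hy
  · have hxf : x ∈ frontier Ω := by rw [hΩ.frontier_eq]; exact ⟨hx, hxΩ⟩
    rw [bdryDist, Metric.infDist_zero_of_mem hxf, Metric.infDist_zero_of_mem (hsub hxf)]

lemma infDist_compl_pos (hΩ : IsOpen Ω) (hne : Ω ≠ univ) {x : RN N} (hx : x ∈ Ω) :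
    0 < Metric.infDist x Ωᶜ :=
  (hΩ.isClosed_compl.notMem_iff_infDist_pos (nonempty_compl.2 hne)).1 (by simpa using hx)

lemma exists_bdryDist_eq_linfNorm (hΩ : IsOpen Ω) (hΩn : Ω.Nonempty)
    (hΩb : Bornology.IsBounded Ω) (hne : Ω ≠ univ) :
    0 < linfNorm Ω (bdryDist Ω) ∧
      (∀ x, Metric.infDist x Ωᶜ ≤ linfNorm Ω (bdryDist Ω)) ∧
      ∃ x ∈ Ω, Metric.infDist x Ωᶜ = linfNorm Ω (bdryDist Ω) := by
  obtain ⟨y, hy⟩ := hΩn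
  obtain ⟨x, hx, hmax⟩ := hΩb.isCompact_closure.exists_isMaxOn ⟨y, subset_closure hy⟩
    (Metric.continuous_infDist_pt Ωᶜ).continuousOn
  have hxp : 0 < Metric.infDist x Ωᶜ :=
    (infDist_compl_pos hΩ hne hy).trans_le (hmax (subset_closure hy))
  have hxΩ : x ∈ Ω := by
    by_contra hxΩ
    exact hxp.ne' (Metric.infDist_zero_of_mem hxΩ)
  have hb : ∀ z ∈ Ω, ‖bdryDist Ω z‖ ≤ Metric.infDist x Ωᶜ := fun z hz => by
    rw [← infDist_compl_eq_bdryDist hΩ hne (subset_closure hz), Real.norm_of_nonneg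
      Metric.infDist_nonneg]
    exact hmax (subset_closure hz)
  have heq : Metric.infDist x Ωᶜ = linfNorm Ω (bdryDist Ω) := by
    refine le_antisymm ?_ (linfNorm_le hΩ.measurableSet hxp.le hb)
    have := norm_le_linfNorm hΩ (Metric.continuous_infDist_pt (frontier Ω)).continuousOn hb hxΩ
    rwa [← bdryDist, ← infDist_compl_eq_bdryDist hΩ hne hx, Real.norm_of_nonneg
      Metric.infDist_nonneg] at this
  refine ⟨heq ▸ hxp, fun z => ?_, x, hxΩ, heq⟩
  by_cases hz : z ∈ Ω
  · exact heq ▸ hmax (subset_closure hz)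
  · rw [Metric.infDist_zero_of_mem hz]
    exact heq ▸ hxp.le

/-! ### Lipschitz functions and `W^{1,∞}` -/

lemma gradient_apply (f : RN N → ℝ) (x : RN N) (i : Fin N) : gradient f x i = pderiv i f x := by
  have h : inner ℝ (gradient f x) (EuclideanSpace.single i (1 : ℝ)) = pderiv i f x :=
    InnerProductSpace.toDual_symm_apply
  rw [← h, EuclideanSpace.inner_single_right]
  simp

lemma measurable_gradient (f : RN N → ℝ) : Measurable (gradient f) :=
  (InnerProductSpace.toDual ℝ (RN N)).symm.continuous.measurable.comp (measurable_fderiv ℝ f)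

lemma norm_gradient_le_of_lipschitz {f : RN N → ℝ} {K : NNReal} (hf : LipschitzWith K f)
    (x : RN N) : ‖gradient f x‖ ≤ K := by
  rw [gradient, LinearIsometryEquiv.norm_map]
  exact norm_fderiv_le_of_lipschitz ℝ hf

/-- Rademacher's theorem gives a weak gradient to a Lipschitz function. -/
lemma memW1Inf_of_lipschitzWith {f : RN N → ℝ} {K : NNReal} (hf : LipschitzWith K f)
    (hΩ : IsOpen Ω) (hΩb : Bornology.IsBounded Ω) : MemW1Inf Ω f (gradient f) := by
  have hL : ∀ μ : Measure (RN N), MemLp (gradient f) ⊤ μ := fun μ =>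
    memLp_top_of_bound (measurable_gradient f).aestronglyMeasurable K
      (.of_forall (norm_gradient_le_of_lipschitz hf))
  obtain ⟨M, hM⟩ := hΩb.isCompact_closure.exists_bound_of_continuousOn hf.continuous.continuousOn
  refine ⟨memLp_top_of_bound hf.continuous.aestronglyMeasurable M ?_, ⟨?_, ?_, ?_⟩, hL _⟩
  · filter_upwards [ae_restrict_mem hΩ.measurableSet] with x hx using hM x (subset_closure hx)
  · exact hf.continuous.locallyIntegrable.locallyIntegrableOn Ω
  · exact ((hL volume).locallyIntegrable le_top).locallyIntegrableOn Ω
  · intro φ hφ i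
    have hφ1 := hφ.contDiff_one
    obtain ⟨D, hD⟩ := hφ1.lipschitzWith_of_hasCompactSupport hφ.2.1 (by simp)
    have h := LipschitzWith.integral_lineDeriv_mul_eq (μ := volume) hf hD hφ.2.1
      (EuclideanSpace.single i (1 : ℝ))
    have hp : ∀ x ∉ Ω, pderiv i φ x = 0 := fun x hx => by
      rw [← gradient_apply, hφ.gradient_eq_zero hx]; simp
    rw [setIntegral_eq_integral_of_forall_compl_eq_zero fun x hx => by rw [hp x hx, mul_zero],
      setIntegral_eq_integral_of_forall_compl_eq_zero fun x hx => by rw [hφ.eq_zero hx, mul_zero]]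
    have h1 : ∫ x, gradient f x i * φ x =
        ∫ x, lineDeriv ℝ f x (EuclideanSpace.single i (1 : ℝ)) * φ x := by
      refine integral_congr_ae ?_
      filter_upwards [hf.ae_differentiableAt (μ := volume)] with x hx
      rw [gradient_apply, pderiv, hx.lineDeriv_eq_fderiv]
    rw [h1, h, ← integral_neg]
    congr 1
    ext x
    rw [(hφ.differentiable x).lineDeriv_eq_fderiv, map_neg, pderiv]
    ring

/-! ### A `W^{1,∞}` function is Lipschitz on balls -/

/-- The definition of the weak gradient, for derivatives in an arbitrary direction. -/
lemma IsTestFunction.integral_mul_fderiv {u : RN N → ℝ} {G : RN N → RN N} {φ : RN N → ℝ}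
    (hu : IntegrableOn u Ω) (hG : HasWeakGradient Ω u G) (hGi : MemLp G ⊤ (volume.restrict Ω))
    (hφ : IsTestFunction Ω φ) (v : RN N) :
    ∫ x in Ω, u x * fderiv ℝ φ x v = - ∫ x in Ω, inner ℝ (G x) v * φ x := by
  have hφ1 := hφ.contDiff_one
  have e1 : ∀ x, u x * fderiv ℝ φ x v = ∑ i, v i * (u x * pderiv i φ x) := by
    intro x
    have hv : v = ∑ i, v i • EuclideanSpace.single i (1 : ℝ) := by
      simpa using ((EuclideanSpace.basisFun (Fin N) ℝ).sum_repr v).symm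
    conv_lhs => rw [hv, map_sum, Finset.mul_sum]
    refine Finset.sum_congr rfl fun i _ => ?_
    rw [map_smul, smul_eq_mul, pderiv]
    ring
  have e2 : ∀ x, inner ℝ (G x) v * φ x = ∑ i, v i * (G x i * φ x) := by
    intro x
    rw [PiLp.inner_apply, Finset.sum_mul]
    refine Finset.sum_congr rfl fun i _ => ?_
    simp only [RCLike.inner_apply, conj_trivial]
    ring
  have hφL : MemLp φ 1 (volume.restrict Ω) :=
    (hφ.1.continuous.memLp_of_hasCompactSupport hφ.2.1).restrict _
  simp_rw [e1, e2]
  rw [integral_finsetSum, integral_finsetSum, ← Finset.sum_neg_distrib]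
  · refine Finset.sum_congr rfl fun i _ => ?_
    rw [integral_const_mul, integral_const_mul, hG.2.2 φ hφ i]
    ring
  · intro i _
    refine Integrable.const_mul ?_ _
    refine (MemLp.integrable_mul (p := ⊤) (q := 1) ?_ hφL)
    refine MemLp.of_le hGi ?_ (.of_forall fun x => ?_)
    · have := hGi.1
      exact (EuclideanSpace.proj (𝕜 := ℝ) i).continuous.comp_aestronglyMeasurable this
    · exact PiLp.norm_apply_le (G x) i
  · intro i _
    refine Integrable.const_mul ?_ _
    have hc : Continuous (pderiv i φ) := by
      have := hφ1.continuous_fderiv (by simp)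
      exact this.clm_apply continuous_const
    have hs : HasCompactSupport (pderiv i φ) := 
      (hφ.2.1.fderiv ℝ).comp_left (g := fun A : RN N →L[ℝ] ℝ =>
        A (EuclideanSpace.single i (1 : ℝ))) rfl
    exact MemLp.integrable_mul (p := 1) (q := ⊤) (memLp_one_iff_integrable.2 hu)
      ((hc.memLp_of_hasCompactSupport hs).restrict _)

/-- A continuous function with bounded weak gradient satisfies the Lipschitz estimate from the centre
of a ball in `Ω`, because its mollifications do. -/
lemma abs_sub_le_of_hasWeakGradient {u : RN N → ℝ} {G : RN N → RN N} (hΩ : IsOpen Ω)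
    (huc : ContinuousOn u Ω) (hu : IntegrableOn u Ω) (hG : HasWeakGradient Ω u G)
    (hGi : MemLp G ⊤ (volume.restrict Ω)) {x y : RN N} {r : ℝ} (hr : Metric.ball x r ⊆ Ω)
    (hy : y ∈ Metric.ball x r) : |u y - u x| ≤ linfNorm Ω G * dist y x := by
  set L := linfNorm Ω G with hL
  have hL0 : 0 ≤ L := ENNReal.toReal_nonneg
  have hyr : dist y x < r := hy
  have hr0 : 0 < r := dist_nonneg.trans_lt hyr
  set U := Ω.indicator u with hU
  have hUi : Integrable U := hu.integrable_indicator hΩ.measurableSet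
  have hUc : ∀ z ∈ Ω, ContinuousAt U z := fun z hz =>
    (huc.continuousAt (hΩ.mem_nhds hz)).congr (by
      filter_upwards [hΩ.mem_nhds hz] with w hw using (indicator_of_mem hw u).symm)
  have hxΩ : x ∈ Ω := hr (Metric.mem_ball_self hr0)
  refine le_of_forall_pos_le_add fun ε hε => ?_
  obtain ⟨δ₁, hδ₁, h₁⟩ := Metric.continuousAt_iff.1 (hUc x hxΩ) (ε / 2) (by positivity)
  obtain ⟨δ₂, hδ₂, h₂⟩ := Metric.continuousAt_iff.1 (hUc y (hr hy)) (ε / 2) (by positivity)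
  obtain ⟨ρ, hρ1, hρ2⟩ := exists_between hyr
  have hρ0 : 0 < ρ := dist_nonneg.trans_lt hρ1
  set δ := min (min δ₁ δ₂) ((r - ρ) / 2) with hδ
  have hδ0 : 0 < δ := by
    have : 0 < r - ρ := by linarith
    positivity
  let η : ContDiffBump (0 : RN N) := ⟨δ / 2, δ, by positivity, by linarith⟩
  have hηs : ContDiff ℝ ∞ (η.normed volume) := η.contDiff_normed
  have hηc : HasCompactSupport (η.normed volume) := η.hasCompactSupport_normed
  set h := convolution (η.normed volume) U (ContinuousLinearMap.lsmul ℝ ℝ) volume with hh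
  have hd : ∀ z, HasFDerivAt h (convolution U (fderiv ℝ (η.normed volume))
      ((ContinuousLinearMap.lsmul ℝ ℝ).flip.precompR (RN N)) volume z) z := by
    intro z
    rw [hh, ← convolution_flip]
    exact hηc.hasFDerivAt_convolution_right _ hUi.locallyIntegrable (hηs.of_le (by simp)) z
  have hbound : ∀ z ∈ Metric.ball x ρ, ‖convolution U (fderiv ℝ (η.normed volume))
      ((ContinuousLinearMap.lsmul ℝ ℝ).flip.precompR (RN N)) volume z‖ ≤ L := by
    intro z hz
    refine ContinuousLinearMap.opNorm_le_bound _ hL0 fun v => ?_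
    rw [convolution_precompR_apply _ hUi.locallyIntegrable (hηc.fderiv ℝ)
      (hηs.continuous_fderiv (by simp))]
    set φ : RN N → ℝ := fun t => η.normed volume (z - t) with hφ
    have hφs : Function.support φ ⊆ Metric.ball z δ := by
      intro t ht
      have : z - t ∈ Function.support (η.normed volume) := ht
      rw [η.support_normed_eq] at this
      simpa [dist_eq_norm, norm_sub_rev, η] using this
    have hφt : tsupport φ ⊆ Metric.closedBall z δ :=
      closure_minimal (hφs.trans Metric.ball_subset_closedBall) Metric.isClosed_closedBall
    have hφT : IsTestFunction Ω φ := by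
      refine ⟨hηs.comp (by fun_prop), HasCompactSupport.of_support_subset_isCompact
        (isCompact_closedBall z δ) (hφs.trans Metric.ball_subset_closedBall), hφt.trans ?_⟩
      intro t ht
      refine hr ?_
      have h1 : dist t z ≤ δ := ht
      have h2 : dist z x < ρ := hz
      have h3 : δ ≤ (r - ρ) / 2 := min_le_right _ _
      have := dist_triangle t z x
      rw [Metric.mem_ball]
      linarith
    have hfd : ∀ t, fderiv ℝ φ t v = - fderiv ℝ (η.normed volume) (z - t) v := by
      intro t
      have h1 : HasFDerivAt (fun t : RN N => z - t) (-ContinuousLinearMap.id ℝ (RN N)) t :=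
        (hasFDerivAt_id t).const_sub z
      have h2 := ((hηs.differentiable (by simp)) (z - t)).hasFDerivAt.comp t h1
      rw [show fderiv ℝ φ t = _ from h2.fderiv]
      simp
    have hint := hφT.integral_mul_fderiv hu hG hGi v
    have hconv : (convolution U (fun a => fderiv ℝ (η.normed volume) a v)
        (ContinuousLinearMap.lsmul ℝ ℝ).flip volume) z = ∫ t in Ω, inner ℝ (G t) v * φ t := by
      rw [← neg_eq_iff_eq_neg.2 hint, ← integral_neg, convolution,
        ← integral_indicator hΩ.measurableSet]
      congr 1
      ext t
      by_cases ht : t ∈ Ω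
      · simp [hU, ht, hfd, mul_comm]
      · simp [hU, ht]
    rw [hconv]
    have hφint : Integrable φ := hφT.1.continuous.integrable_of_hasCompactSupport hφT.2.1
    have hφ0 : ∀ t, 0 ≤ φ t := fun t => η.nonneg_normed _
    have hone : ∫ t, φ t = 1 := by
      rw [hφ, integral_sub_left_eq_self (fun t => η.normed volume t) volume z]
      exact η.integral_normed
    calc ‖∫ t in Ω, inner ℝ (G t) v * φ t‖ ≤ ∫ t in Ω, L * ‖v‖ * φ t := by
          refine norm_integral_le_of_norm_le (hφint.integrableOn.const_mul _) ?_
          filter_upwards [ae_norm_le_linfNorm hGi] with t ht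
          rw [norm_mul, Real.norm_of_nonneg (hφ0 t)]
          gcongr
          · exact hφ0 t
          · exact (norm_inner_le_norm _ _).trans (by gcongr)
      _ ≤ L * ‖v‖ * 1 := by
          rw [integral_const_mul, ← hone]
          exact mul_le_mul_of_nonneg_left (setIntegral_le_integral hφint (.of_forall hφ0))
            (by positivity)
      _ = L * ‖v‖ := mul_one _
  have hmv := (convex_ball x ρ).norm_image_sub_le_of_norm_hasFDerivWithin_le
    (fun z _ => (hd z).hasFDerivWithinAt) hbound (Metric.mem_ball_self hρ0)
    (show y ∈ Metric.ball x ρ from hρ1)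
  have hcx : dist (h x) (U x) ≤ ε / 2 := η.dist_normed_convolution_le hUi.1 fun z hz =>
    (h₁ (lt_of_lt_of_le hz ((min_le_left _ _).trans (min_le_left _ _)))).le
  have hcy : dist (h y) (U y) ≤ ε / 2 := η.dist_normed_convolution_le hUi.1 fun z hz =>
    (h₂ (lt_of_lt_of_le hz ((min_le_left _ _).trans (min_le_right _ _)))).le
  rw [Real.dist_eq, hU, indicator_of_mem hxΩ] at hcx
  rw [Real.dist_eq, hU, indicator_of_mem (hr hy)] at hcy
  rw [Real.norm_eq_abs, ← dist_eq_norm] at hmv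
  rw [abs_le] at *
  constructor <;> linarith

/-- A function of `C₀ ∩ W^{1,∞}` grows from the boundary at most at the rate `‖∇u‖_∞`. -/
lemma MemW1Inf.abs_le {u : RN N → ℝ} {G : RN N → RN N} (h : MemW1Inf Ω u G) (h0 : MemC0 Ω u)
    (hΩ : IsOpen Ω) (hΩb : Bornology.IsBounded Ω) (hne : Ω ≠ univ) {x : RN N} (hx : x ∈ Ω) :
    |u x| ≤ linfNorm Ω G * Metric.infDist x Ωᶜ := by
  obtain ⟨y, hy, hxy⟩ := exists_mem_frontier_infDist_compl_eq_dist hx hne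
  have hr : Metric.ball x (Metric.infDist x Ωᶜ) ⊆ Ω := Metric.ball_infDist_compl_subset
  have hrp := infDist_compl_pos hΩ hne hx
  have hui : IntegrableOn u Ω :=
    (h0.1.integrableOn_compact hΩb.isCompact_closure).mono_set subset_closure
  have hball := fun z (hz : z ∈ Metric.ball x (Metric.infDist x Ωᶜ)) =>
    abs_sub_le_of_hasWeakGradient hΩ (h0.1.mono subset_closure) hui h.hasWeakGradient
      h.memLp_grad hr hz
  have hcl : closure (Metric.ball x (Metric.infDist x Ωᶜ)) ⊆ closure Ω := closure_mono hr
  have hyc : y ∈ closure (Metric.ball x (Metric.infDist x Ωᶜ)) := by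
    rw [closure_ball _ hrp.ne', Metric.mem_closedBall, hxy, dist_comm]
  have hc1 : ContinuousOn (fun z => |u z - u x|) (closure (Metric.ball x (Metric.infDist x Ωᶜ))) :=
    ((h0.1.mono hcl).sub continuousOn_const).abs
  have := le_on_closure hball hc1
    (Continuous.continuousOn (f := fun z => linfNorm Ω G * dist z x) (by fun_prop)) hyc
  rw [h0.2 y hy, zero_sub, abs_neg] at this
  rwa [hxy, dist_comm]

/-- The scaled distance to the boundary realises the infimum defining `Λ_∞`. -/
theorem lambdaInf_eq (hΩ : IsOpen Ω) (hΩn : Ω.Nonempty) (hΩb : Bornology.IsBounded Ω)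
    (hne : Ω ≠ univ) : lambdaInf Ω = (linfNorm Ω (bdryDist Ω))⁻¹ := by
  obtain ⟨hR, hle, x₀, hx₀, hx₀R⟩ := exists_bdryDist_eq_linfNorm hΩ hΩn hΩb hne
  set R := linfNorm Ω (bdryDist Ω) with hRdef
  set f : RN N → ℝ := fun x => R⁻¹ * Metric.infDist x Ωᶜ with hf
  have hfL : LipschitzWith ⟨R⁻¹, by positivity⟩ f := by
    refine LipschitzWith.of_dist_le_mul fun x y => ?_
    rw [Real.dist_eq, hf]
    simp only
    rw [← mul_sub, abs_mul, abs_of_pos (by positivity : 0 < R⁻¹)]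
    refine mul_le_mul_of_nonneg_left ?_ (by positivity)
    have := (Metric.lipschitz_infDist_pt Ωᶜ).dist_le_mul x y
    simpa [Real.dist_eq] using this
  have hfb : ∀ x ∈ Ω, ‖f x‖ ≤ 1 := fun x _ => by
    rw [hf, Real.norm_of_nonneg (mul_nonneg (by positivity) Metric.infDist_nonneg),
      inv_mul_le_one₀ hR]
    exact hle x
  have hf1 : linfNorm Ω f = 1 := by
    refine le_antisymm (linfNorm_le hΩ.measurableSet zero_le_one hfb) ?_
    have := norm_le_linfNorm hΩ hfL.continuous.continuousOn hfb hx₀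
    rwa [hf, Real.norm_of_nonneg (mul_nonneg (by positivity) Metric.infDist_nonneg), hx₀R,
      inv_mul_cancel₀ hR.ne'] at this
  have hW := memW1Inf_of_lipschitzWith hfL hΩ hΩb
  have hlow : ∀ r ∈ {r : ℝ | ∃ (u : RN N → ℝ) (G : RN N → RN N), MemC0 Ω u ∧ MemW1Inf Ω u G ∧
      linfNorm Ω u = 1 ∧ r = linfNorm Ω G}, R⁻¹ ≤ r := by
    rintro r ⟨u, G, hu0, huG, hu1, rfl⟩
    have hG0 : 0 ≤ linfNorm Ω G := ENNReal.toReal_nonneg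
    rw [inv_le_iff_one_le_mul₀ hR, ← hu1]
    refine linfNorm_le hΩ.measurableSet (by positivity) fun x hx => ?_
    refine (huG.abs_le hu0 hΩ hΩb hne hx).trans ?_
    gcongr
    exact hle x
  have hmem : linfNorm Ω (gradient f) ∈ {r : ℝ | ∃ (u : RN N → ℝ) (G : RN N → RN N), MemC0 Ω u ∧
      MemW1Inf Ω u G ∧ linfNorm Ω u = 1 ∧ r = linfNorm Ω G} := by
    refine ⟨f, gradient f, ⟨hfL.continuous.continuousOn, fun x hx => ?_⟩, hW, hf1, rfl⟩
    rw [hΩ.frontier_eq] at hx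
    simp only [hf]
    rw [Metric.infDist_zero_of_mem hx.2, mul_zero]
  refine le_antisymm ((csInf_le ⟨R⁻¹, hlow⟩ hmem).trans ?_) (le_csInf ⟨_, hmem⟩ hlow)
  exact linfNorm_le hΩ.measurableSet (by positivity)
    fun x _ => norm_gradient_le_of_lipschitz hfL x

end

/-! ### The limit of the Sobolev constants -/

section
variable {N : ℕ} {Ω : Set (RN N)} {p q : ℝ}

/-- Truncating and mollifying the distance function produces a test function with gradient at most
`1` that is almost as large as the distance to the complement. -/
lemma exists_isTestFunction_infDist_sub_le (hΩb : Bornology.IsBounded Ω) {ε : ℝ} (hε : 0 < ε) :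
    ∃ φ : RN N → ℝ, IsTestFunction Ω φ ∧ (∀ x, ‖gradient φ x‖ ≤ 1) ∧
      ∀ x, Metric.infDist x Ωᶜ - ε ≤ φ x := by
  set δ := ε / 3 with hδ
  have hδ0 : 0 < δ := by positivity
  set f : RN N → ℝ := fun x => max (Metric.infDist x Ωᶜ - 2 * δ) 0 with hf
  have hfL : ∀ x y, |f x - f y| ≤ dist x y := by
    intro x y
    have h1 := (Metric.lipschitz_infDist_pt Ωᶜ).dist_le_mul x y
    rw [Real.dist_eq, NNReal.coe_one, one_mul] at h1
    refine (abs_max_sub_max_le_abs _ _ _).trans ?_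
    simpa using h1
  have hfLip : LipschitzWith 1 f := LipschitzWith.of_dist_le_mul fun x y => by
    simpa [Real.dist_eq] using hfL x y
  have hfc := hfLip.continuous
  let η : ContDiffBump (0 : RN N) := ⟨δ / 2, δ, by positivity, by linarith⟩
  have hηs : ContDiff ℝ ∞ (η.normed volume) := η.contDiff_normed
  have hηc : HasCompactSupport (η.normed volume) := η.hasCompactSupport_normed
  set g := convolution (η.normed volume) f (ContinuousLinearMap.lsmul ℝ ℝ) volume with hg
  have hgs : ContDiff ℝ ∞ g := hηc.contDiff_convolution_left _ hηs hfc.locallyIntegrable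
  have hgf : ∀ x, |g x - f x| ≤ δ := fun x =>
    η.dist_normed_convolution_le hfc.aestronglyMeasurable fun z hz =>
      ((hfL z x).trans (le_of_lt hz))
  have hint : ∀ x, Integrable fun t => η.normed volume t * f (x - t) := fun x =>
    Continuous.integrable_of_hasCompactSupport
      (hηs.continuous.mul (hfc.comp (by fun_prop))) hηc.mul_right
  have hgL : LipschitzWith 1 g := by
    refine LipschitzWith.of_dist_le_mul fun x y => ?_
    rw [NNReal.coe_one, one_mul, Real.dist_eq, hg, convolution, convolution]
    simp only [ContinuousLinearMap.lsmul_apply, smul_eq_mul]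
    rw [← integral_sub (hint x) (hint y), ← Real.norm_eq_abs]
    calc ‖∫ t, η.normed volume t * f (x - t) - η.normed volume t * f (y - t)‖
        ≤ ∫ t, η.normed volume t * dist x y := by
          refine norm_integral_le_of_norm_le (η.integrable_normed.mul_const _) (.of_forall fun t => ?_)
          rw [← mul_sub, norm_mul, Real.norm_of_nonneg (η.nonneg_normed t)]
          refine mul_le_mul_of_nonneg_left ?_ (η.nonneg_normed t)
          simpa using hfL (x - t) (y - t)
      _ = dist x y := by rw [integral_mul_const, η.integral_normed, one_mul]
  have hgz : ∀ x, Metric.infDist x Ωᶜ < δ → g x = 0 := by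
    intro x hx
    have hz : ∀ z ∈ Metric.ball x η.rOut, f z = 0 := by
      intro z hz
      have h1 : Metric.infDist z Ωᶜ ≤ Metric.infDist x Ωᶜ + dist z x :=
        Metric.infDist_le_infDist_add_dist
      have h2 : dist z x < δ := hz
      exact max_eq_right (by linarith)
    have h0 : f x = 0 := hz x (Metric.mem_ball_self η.rOut_pos)
    rw [hg, η.normed_convolution_eq_right (fun z hz' => by rw [hz z hz', h0]), h0]
  have hclosed : IsClosed {x : RN N | δ ≤ Metric.infDist x Ωᶜ} :=
    isClosed_le continuous_const (Metric.continuous_infDist_pt _)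
  have hsub : {x : RN N | δ ≤ Metric.infDist x Ωᶜ} ⊆ Ω := by
    intro x hx
    by_contra hxΩ
    have : Metric.infDist x Ωᶜ = 0 := Metric.infDist_zero_of_mem hxΩ
    rw [mem_ofPred_eq, this] at hx
    linarith
  have hsupp : tsupport g ⊆ {x : RN N | δ ≤ Metric.infDist x Ωᶜ} := by
    refine closure_minimal (fun x hx => ?_) hclosed
    by_contra hlt
    exact hx (hgz x (not_le.1 hlt))
  refine ⟨g, ⟨hgs, ?_, hsupp.trans hsub⟩, fun x => ?_, fun x => ?_⟩
  · exact Metric.isCompact_of_isClosed_isBounded (isClosed_tsupport g)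
      (hΩb.subset (hsupp.trans hsub))
  · simpa using norm_gradient_le_of_lipschitz hgL x
  · have h1 := (abs_le.1 (hgf x)).1
    have h2 : Metric.infDist x Ωᶜ - 2 * δ ≤ f x := le_max_left _ _
    linarith

lemma IsTestFunction.memW0 {φ : RN N → ℝ} (h : IsTestFunction Ω φ) (hΩ : IsOpen Ω)
    (hΩb : Bornology.IsBounded Ω) (p : ℝ) : MemW0 Ω p φ (gradient φ) := by
  obtain ⟨D, hD⟩ := h.contDiff_one.lipschitzWith_of_hasCompactSupport h.2.1 (by simp)
  refine ⟨(h.1.continuous.memLp_of_hasCompactSupport h.2.1).restrict _,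
    (memW1Inf_of_lipschitzWith hD hΩ hΩb).hasWeakGradient, (h.memLp_gradient _).restrict _,
    fun _ => φ, fun _ => h, ?_, ?_⟩ <;> simp

lemma sobolevConst_nonneg : 0 ≤ sobolevConst Ω p q := by
  refine Real.sInf_nonneg ?_
  rintro r ⟨u, G, -, -, rfl⟩
  positivity

lemma sobolevConst_le {u : RN N → ℝ} {G : RN N → RN N} (h : MemW0 Ω p u G)
    (hu : (∫ x in Ω, |u x| ^ q) = 1) : sobolevConst Ω p q ≤ ∫ x in Ω, ‖G x‖ ^ p := by
  refine csInf_le ⟨0, ?_⟩ ⟨u, G, h, hu, rfl⟩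
  rintro r ⟨u, G, -, -, rfl⟩
  positivity

lemma gradient_const_mul {φ : RN N → ℝ} {x : RN N} (h : DifferentiableAt ℝ φ x) (c : ℝ) :
    gradient (fun y => c * φ y) x = c • gradient φ x := by
  simp only [gradient, fderiv_const_mul h, map_smul]

lemma integral_rescaled_rpow {φ : RN N → ℝ} (hq : 0 < q) (hJ : 0 < ∫ x in Ω, |φ x| ^ q) :
    ∫ x in Ω, |(∫ x in Ω, |φ x| ^ q) ^ (-(1 / q)) * φ x| ^ q = 1 := by
  set J := ∫ x in Ω, |φ x| ^ q with hJd
  have hc : 0 ≤ J ^ (-(1 / q)) := by positivity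
  simp_rw [abs_mul, abs_of_nonneg hc, Real.mul_rpow hc (abs_nonneg _)]
  rw [integral_const_mul, ← hJd, ← Real.rpow_mul hJ.le, neg_mul, one_div, inv_mul_cancel₀ hq.ne',
    Real.rpow_neg_one, inv_mul_cancel₀ hJ.ne']

/-- The Sobolev inequality for test functions, in homogeneous form. -/
lemma IsTestFunction.sobolevConst_mul_le {φ : RN N → ℝ} (h : IsTestFunction Ω φ) (hΩ : IsOpen Ω)
    (hΩb : Bornology.IsBounded Ω) (hp : 0 < p) (hq : 0 < q) :
    sobolevConst Ω p q * (∫ x in Ω, |φ x| ^ q) ^ (p / q) ≤ ∫ x in Ω, ‖gradient φ x‖ ^ p := by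
  have hJ0 : 0 ≤ ∫ x in Ω, |φ x| ^ q := by positivity
  rcases hJ0.eq_or_lt with hJ | hJ
  · rw [← hJ, Real.zero_rpow (by positivity), mul_zero]
    positivity
  · have h1 := sobolevConst_le ((h.const_mul _).memW0 hΩ hΩb p) (integral_rescaled_rpow hq hJ)
    set J := ∫ x in Ω, |φ x| ^ q with hJd
    have hc : 0 ≤ J ^ (-(1 / q)) := by positivity
    simp_rw [fun x => gradient_const_mul (h.differentiable x) (J ^ (-(1 / q))), norm_smul,
      Real.norm_of_nonneg hc, Real.mul_rpow hc (norm_nonneg _)] at h1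
    rw [integral_const_mul, ← Real.rpow_mul hJ.le] at h1
    calc sobolevConst Ω p q * J ^ (p / q)
        ≤ (J ^ (-(1 / q) * p) * ∫ x in Ω, ‖gradient φ x‖ ^ p) * J ^ (p / q) := by gcongr
      _ = ∫ x in Ω, ‖gradient φ x‖ ^ p := by
        rw [mul_right_comm, ← Real.rpow_add hJ, show -(1 / q) * p + p / q = 0 by ring,
          Real.rpow_zero, one_mul]

/-- A Morrey estimate for a function vanishing off `Ω` bounds it by the inradius of `Ω`, through a
nearest boundary point. -/
lemma abs_le_of_morrey {v : RN N → ℝ} {C K ε : ℝ} (hΩ : IsOpen Ω) (hΩn : Ω.Nonempty)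
    (hΩb : Bornology.IsBounded Ω) (hne : Ω ≠ univ) (hv0 : ∀ x ∉ Ω, v x = 0) (hC : 0 ≤ C)
    (hK : 0 ≤ K) (hε : 0 ≤ ε) (hv : ∀ x a, |v x - v a| ≤ C * (dist x a + 2 * ε) * K) (x : RN N) :
    |v x| ≤ C * (linfNorm Ω (bdryDist Ω) + 2 * ε) * K := by
  obtain ⟨hR, hle, -⟩ := exists_bdryDist_eq_linfNorm hΩ hΩn hΩb hne
  by_cases hx : x ∈ Ω
  · obtain ⟨y, hy, hxy⟩ := exists_mem_frontier_infDist_compl_eq_dist hx hne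
    have h1 := hv x y
    rw [hΩ.frontier_eq] at hy
    rw [hv0 y hy.2, sub_zero, ← hxy] at h1
    refine h1.trans ?_
    have := hle x
    gcongr
  · rw [hv0 x hx, abs_zero]
    positivity

lemma one_le_mul_volume_rpow {v : RN N → ℝ} {M : ℝ} (hΩ : IsOpen Ω) (hΩb : Bornology.IsBounded Ω)
    (hq : 0 < q) (hv : (∫ x in Ω, |v x| ^ q) = 1) (hM : 0 ≤ M) (hb : ∀ x ∈ Ω, |v x| ≤ M) :
    1 ≤ M * (volume Ω).toReal ^ (1 / q) := by
  have hvol : volume Ω ≠ ⊤ := hΩb.measure_lt_top.ne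
  have h1 : 1 ≤ M ^ q * (volume Ω).toReal := by
    calc (1 : ℝ) = ∫ x in Ω, |v x| ^ q := hv.symm
      _ ≤ ∫ x in Ω, M ^ q := by
          refine integral_mono_of_nonneg (.of_forall fun x => by positivity)
            (integrableOn_const hvol) ?_
          filter_upwards [ae_restrict_mem hΩ.measurableSet] with x hx
          exact Real.rpow_le_rpow (abs_nonneg _) (hb x hx) hq.le
      _ = M ^ q * (volume Ω).toReal := by
          rw [setIntegral_const, smul_eq_mul, mul_comm]; rfl
  have h2 := Real.one_le_rpow h1 (by positivity : 0 ≤ 1 / q)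
  rwa [Real.mul_rpow (by positivity) (by positivity), ← Real.rpow_mul hM, mul_one_div_cancel hq.ne',
    Real.rpow_one] at h2

/-- The lower bound for the Sobolev quotient: the Morrey estimate controls the supremum norm, which
in turn controls the `L^q` norm. -/
lemma MemW0.one_le_mul {u : RN N → ℝ} {G : RN N → RN N} (h : MemW0 Ω p u G) (hΩ : IsOpen Ω)
    (hΩn : Ω.Nonempty) (hΩb : Bornology.IsBounded Ω) (hne : Ω ≠ univ) (hp : (N : ℝ) < p)
    (hp1 : 1 ≤ p) (hq : 0 < q) (hu : (∫ x in Ω, |u x| ^ q) = 1) {ε : ℝ} (hε : 0 < ε) :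
    1 ≤ morreyConst N p ε * (linfNorm Ω (bdryDist Ω) + 2 * ε) *
      (∫ x in Ω, ‖G x‖ ^ p) ^ (1 / p) * (volume Ω).toReal ^ (1 / q) := by
  obtain ⟨v, φ, hφ, hφv, hvc, hv0, hvu, hI⟩ :=
    h.exists_continuous_rep hΩb hp hp1 ((ne_univ_iff_exists_notMem _).1 hne)
  have hM := morreyConst_pos hp hε
  have hR := (exists_bdryDist_eq_linfNorm hΩ hΩn hΩb hne).1
  have hb := abs_le_of_morrey hΩ hΩn hΩb hne hv0 hM.le (by positivity) hε.le
    fun x a => abs_sub_le_of_tendstoUniformly hφ hφv hp hp1 hI hε x a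
  set M := morreyConst N p ε * (linfNorm Ω (bdryDist Ω) + 2 * ε) *
    (∫ x in Ω, ‖G x‖ ^ p) ^ (1 / p) with hMd
  refine one_le_mul_volume_rpow hΩ hΩb hq ?_ (by positivity) fun x _ => hb x
  rw [← hu]
  refine integral_congr_ae ?_
  filter_upwards [hvu] with x hx
  rw [hx]

lemma tendsto_rpow_one_div {f : ℝ → ℝ} (hf : Tendsto f atTop atTop) {c : ℝ} (hc : 0 < c) :
    Tendsto (fun p => c ^ (1 / f p)) atTop (𝓝 1) := by
  have h1 : Tendsto (fun p : ℝ => 1 / f p) atTop (𝓝 0) := by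
    simp_rw [one_div]
    exact tendsto_inv_atTop_zero.comp hf
  simpa using tendsto_const_nhds.rpow h1 (Or.inl hc.ne')

/-- The Sobolev constants, to the power `1 / p`, converge to the inverse of the inradius of `Ω`. -/
theorem tendsto_sobolevConst_rpow (hΩ : IsOpen Ω) (hΩn : Ω.Nonempty)
    (hΩb : Bornology.IsBounded Ω) (hne : Ω ≠ univ) {q : ℝ → ℝ} (hq : Tendsto q atTop atTop) :
    Tendsto (fun p : ℝ => sobolevConst Ω p (q p) ^ (1 / p)) atTop
      (𝓝 (linfNorm Ω (bdryDist Ω))⁻¹) := by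
  obtain ⟨hR, hle, x₀, hx₀, hx₀R⟩ := exists_bdryDist_eq_linfNorm hΩ hΩn hΩb hne
  set R := linfNorm Ω (bdryDist Ω) with hRdef
  have hvol : volume Ω ≠ ⊤ := hΩb.measure_lt_top.ne
  have hvol0 : 0 < (volume Ω).toReal := ENNReal.toReal_pos (hΩ.measure_pos _ hΩn).ne' hvol
  have hpq : ∀ᶠ p : ℝ in atTop, (N : ℝ) < p ∧ 1 ≤ p ∧ 0 < q p :=
    (eventually_gt_atTop _).and ((eventually_ge_atTop _).and (hq.eventually_gt_atTop 0))
  -- A test function close to the distance function bounds the constants from above and shows that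
  -- the class of competitors is not empty.
  have key : ∀ ε > 0, ε < R → ∃ φ : RN N → ℝ, IsTestFunction Ω φ ∧ (∀ x, ‖gradient φ x‖ ≤ 1) ∧
      ∃ m > 0, ∀ q : ℝ, 0 < q → (R - ε) ^ q * m ≤ ∫ x in Ω, |φ x| ^ q := by
    intro ε hε hεR
    obtain ⟨φ, hφ, hφ1, hφd⟩ := exists_isTestFunction_infDist_sub_le hΩb
      (by positivity : 0 < ε / 2)
    have hopen : IsOpen (Ω ∩ φ ⁻¹' Ioi (R - ε)) :=
      hΩ.inter (isOpen_Ioi.preimage hφ.1.continuous)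
    have hmem : x₀ ∈ Ω ∩ φ ⁻¹' Ioi (R - ε) := by
      refine ⟨hx₀, ?_⟩
      have := hφd x₀
      rw [hx₀R] at this
      rw [mem_preimage, mem_Ioi]
      linarith
    have hfin : volume (Ω ∩ φ ⁻¹' Ioi (R - ε)) ≠ ⊤ := measure_ne_top_of_subset inter_subset_left hvol
    refine ⟨φ, hφ, hφ1, (volume (Ω ∩ φ ⁻¹' Ioi (R - ε))).toReal,
      ENNReal.toReal_pos (hopen.measure_pos _ ⟨x₀, hmem⟩).ne' hfin, fun q hq => ?_⟩
    have hcont : Continuous fun x => |φ x| ^ q :=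
      hφ.1.continuous.abs.rpow_const fun _ => Or.inr hq.le
    have hint : Integrable fun x => |φ x| ^ q := by
      refine hcont.integrable_of_hasCompactSupport (hφ.2.1.comp_left (g := fun t => |t| ^ q) ?_)
      simp [Real.zero_rpow hq.ne']
    calc (R - ε) ^ q * (volume (Ω ∩ φ ⁻¹' Ioi (R - ε))).toReal
        = ∫ x in Ω ∩ φ ⁻¹' Ioi (R - ε), (R - ε) ^ q := by
          rw [setIntegral_const, smul_eq_mul, mul_comm]; rfl
      _ ≤ ∫ x in Ω ∩ φ ⁻¹' Ioi (R - ε), |φ x| ^ q := by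
          refine setIntegral_mono_on (integrableOn_const hfin) hint.integrableOn hopen.measurableSet
            fun x hx => ?_
          have h1 : R - ε < φ x := hx.2
          exact Real.rpow_le_rpow (by linarith) (h1.le.trans (le_abs_self _)) hq.le
      _ ≤ ∫ x in Ω, |φ x| ^ q :=
          setIntegral_mono_set hint.integrableOn (.of_forall fun x => by positivity)
            (.of_forall inter_subset_left)
  rw [tendsto_order]
  constructor
  · intro a ha
    obtain ⟨ε, hε, hεa⟩ : ∃ ε > 0, a < (R + 2 * ε)⁻¹ := by
      have hc : ContinuousAt (fun ε : ℝ => (R + 2 * ε)⁻¹) 0 :=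
        ContinuousAt.inv₀ (by fun_prop) (by simpa using hR.ne')
      have : ∀ᶠ ε in 𝓝 (0 : ℝ), a < (R + 2 * ε)⁻¹ :=
        hc.eventually (lt_mem_nhds (by simpa using ha))
      obtain ⟨ε, h1, h2⟩ := ((this.filter_mono nhdsWithin_le_nhds).and
        (self_mem_nhdsWithin : Ioi (0 : ℝ) ∈ 𝓝[>] 0)).exists
      exact ⟨ε, h2, h1⟩
    have hlim : Tendsto (fun p => (morreyConst N p ε * (R + 2 * ε) *
        (volume Ω).toReal ^ (1 / q p))⁻¹) atTop (𝓝 (1 * (R + 2 * ε) * 1)⁻¹) :=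
      (((tendsto_morreyConst N hε).mul tendsto_const_nhds).mul
        (tendsto_rpow_one_div hq hvol0)).inv₀ (by positivity)
    filter_upwards [hpq, hlim.eventually (lt_mem_nhds (by simpa using hεa))] with p hp hpa
    obtain ⟨hpN, hp1, hq0⟩ := hp
    refine hpa.trans_le ?_
    have hC := morreyConst_pos (N := N) hpN hε
    set m := (morreyConst N p ε * (R + 2 * ε) * (volume Ω).toReal ^ (1 / q p))⁻¹ with hm
    have hm0 : 0 < m := by positivity
    rw [one_div, Real.le_rpow_inv_iff_of_pos hm0.le sobolevConst_nonneg (by linarith)]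
    obtain ⟨φ, hφ, -, m', hm', hφm⟩ := key (R / 2) (by positivity) (by linarith)
    have hJ : 0 < ∫ x in Ω, |φ x| ^ q p :=
      lt_of_lt_of_le (mul_pos (Real.rpow_pos_of_pos (show 0 < R - R / 2 by linarith) _) hm') (hφm _ hq0)
    refine le_csInf ⟨_, _, _, (hφ.const_mul _).memW0 hΩ hΩb p, integral_rescaled_rpow hq0 hJ,
      rfl⟩ ?_
    rintro r ⟨u, G, hu, hu1, rfl⟩
    have h1 := hu.one_le_mul hΩ hΩn hΩb hne hpN hp1 hq0 hu1 hε
    rw [← Real.le_rpow_inv_iff_of_pos hm0.le (by positivity) (by linarith), hm, ← one_div p,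
      inv_le_iff_one_le_mul₀ (by positivity)]
    refine h1.trans (le_of_eq ?_)
    ring
  · intro a ha
    obtain ⟨ε, hε, hεR, hεa⟩ : ∃ ε > 0, ε < R ∧ (R - ε)⁻¹ < a := by
      have hc : ContinuousAt (fun ε : ℝ => (R - ε)⁻¹) 0 :=
        ContinuousAt.inv₀ (by fun_prop) (by simpa using hR.ne')
      have : ∀ᶠ ε in 𝓝 (0 : ℝ), (R - ε)⁻¹ < a :=
        hc.eventually (gt_mem_nhds (by simpa using ha))
      obtain ⟨ε, h1, h2⟩ := (((this.and (gt_mem_nhds hR)).filter_mono nhdsWithin_le_nhds).and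
        (self_mem_nhdsWithin : Ioi (0 : ℝ) ∈ 𝓝[>] 0)).exists
      exact ⟨ε, h2, h1.2, h1.1⟩
    obtain ⟨φ, hφ, hφ1, m, hm, hφm⟩ := key ε hε hεR
    have hRε : 0 < R - ε := by linarith
    have hlim : Tendsto (fun p => (volume Ω).toReal ^ (1 / p) * ((R - ε) * m ^ (1 / q p))⁻¹) atTop
        (𝓝 (1 * ((R - ε) * 1)⁻¹)) :=
      (tendsto_rpow_one_div tendsto_id hvol0).mul
        ((tendsto_const_nhds.mul (tendsto_rpow_one_div hq hm)).inv₀ (by positivity))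
    filter_upwards [hpq, hlim.eventually (gt_mem_nhds (by simpa using hεa))] with p hp hpa
    obtain ⟨hpN, hp1, hq0⟩ := hp
    refine lt_of_le_of_lt ?_ hpa
    have hp0 : 0 < p := by linarith
    have h1 := hφ.sobolevConst_mul_le hΩ hΩb hp0 hq0
    have h2 : ∫ x in Ω, ‖gradient φ x‖ ^ p ≤ (volume Ω).toReal := by
      calc ∫ x in Ω, ‖gradient φ x‖ ^ p ≤ ∫ x in Ω, (1 : ℝ) :=
            integral_mono_of_nonneg (.of_forall fun x => by positivity) (integrableOn_const hvol)
              (.of_forall fun x => Real.rpow_le_one (norm_nonneg _) (hφ1 x) hp0.le)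
        _ = (volume Ω).toReal := by rw [setIntegral_const, smul_eq_mul, mul_one]; rfl
    have h3 : sobolevConst Ω p (q p) * ((R - ε) ^ (q p) * m) ^ (p / q p) ≤ (volume Ω).toReal :=
      le_trans (mul_le_mul_of_nonneg_left (Real.rpow_le_rpow (by positivity) (hφm _ hq0)
        (by positivity)) sobolevConst_nonneg) (h1.trans h2)
    rw [← div_eq_mul_inv, le_div_iff₀ (by positivity)]
    have h4 := Real.rpow_le_rpow (mul_nonneg sobolevConst_nonneg (by positivity)) h3
      (by positivity : 0 ≤ 1 / p)
    rw [Real.mul_rpow sobolevConst_nonneg (by positivity), ← Real.rpow_mul (by positivity),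
      show p / q p * (1 / p) = 1 / q p by field_simp, Real.mul_rpow (by positivity) hm.le,
      ← Real.rpow_mul hRε.le, mul_one_div_cancel hq0.ne', Real.rpow_one] at h4
    exact h4

end

/-! ### Comparison of extremal functions with `p`-subharmonic functions -/

section
variable {N : ℕ} {Ω : Set (RN N)} {p q : ℝ}

/-- The tangent line inequality for the convex function `‖·‖ ^ p`. -/
lemma norm_rpow_sub_le {E : Type*} [NormedAddCommGroup E] [InnerProductSpace ℝ E] (hp : 2 < p)
    (a b : E) : ‖b‖ ^ p - ‖a‖ ^ p ≤ p * inner ℝ (‖b‖ ^ (p - 2) • b) (b - a) := by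
  rcases eq_or_ne b 0 with rfl | hb
  · rw [norm_zero, Real.zero_rpow (by linarith), smul_zero, inner_zero_left]
    have : 0 ≤ ‖a‖ ^ p := by positivity
    linarith
  have hr : 0 < ‖b‖ := norm_pos_iff.2 hb
  have hbern := one_add_mul_self_le_rpow_one_add (s := ‖a‖ / ‖b‖ - 1)
    (by have : 0 ≤ ‖a‖ / ‖b‖ := by positivity
        linarith) (p := p) (by linarith)
  rw [add_sub_cancel, Real.div_rpow (norm_nonneg _) hr.le, le_div_iff₀ (by positivity)] at hbern
  have hsplit : ‖b‖ ^ p = ‖b‖ ^ (p - 2) * ‖b‖ ^ 2 := by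
    rw [← Real.rpow_natCast, ← Real.rpow_add hr]
    norm_num
  have hin : inner ℝ (‖b‖ ^ (p - 2) • b) (b - a) ≥ ‖b‖ ^ (p - 2) * (‖b‖ ^ 2 - ‖b‖ * ‖a‖) := by
    rw [real_inner_smul_left, inner_sub_right, real_inner_self_eq_norm_sq]
    gcongr
    exact real_inner_le_norm b a
  have hp0 : 0 < p := by linarith
  have h2 : (1 + p * (‖a‖ / ‖b‖ - 1)) * ‖b‖ ^ p =
      ‖b‖ ^ p - p * (‖b‖ ^ (p - 2) * (‖b‖ ^ 2 - ‖b‖ * ‖a‖)) := by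
    rw [hsplit]
    field_simp
    ring
  rw [h2] at hbern
  nlinarith

/-- The divergence of a vector field. -/
noncomputable def divergence (V : RN N → RN N) (x : RN N) : ℝ :=
  ∑ i, fderiv ℝ V x (EuclideanSpace.single i 1) i

lemma continuous_divergence {V : RN N → RN N} (hV : ContDiff ℝ 1 V) :
    Continuous (divergence V) := by
  have := hV.continuous_fderiv (by simp)
  unfold divergence
  refine continuous_finsetSum _ fun i _ => ?_
  exact (EuclideanSpace.proj (𝕜 := ℝ) i).continuous.comp (this.clm_apply continuous_const)

/-- The divergence theorem, with the test function `w` carrying the compact support. -/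
lemma integral_inner_gradient {V : RN N → RN N} (hV : ContDiff ℝ 1 V) {w : RN N → ℝ}
    (hw : ContDiff ℝ 1 w) (hwc : HasCompactSupport w) :
    ∫ x, inner ℝ (V x) (gradient w x) = - ∫ x, divergence V x * w x := by
  have hVi : ∀ i, ContDiff ℝ 1 fun x => V x i := fun i => (contDiff_euclidean.1 hV) i
  have hder : ∀ i x, fderiv ℝ (fun x => V x i) x (EuclideanSpace.single i 1) =
      fderiv ℝ V x (EuclideanSpace.single i 1) i := by
    intro i x
    have h := ((EuclideanSpace.proj (𝕜 := ℝ) i).hasFDerivAt (x := V x)).comp x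
      (hV.differentiable (by simp) x).hasFDerivAt
    rw [show fderiv ℝ (fun x => V x i) x = _ from h.fderiv]
    rfl
  have hwd : ∀ i, Continuous fun x => fderiv ℝ w x (EuclideanSpace.single i 1) := fun i =>
    (hw.continuous_fderiv (by simp)).clm_apply continuous_const
  have hws : ∀ i, HasCompactSupport fun x => fderiv ℝ w x (EuclideanSpace.single i 1) := fun i =>
    (hwc.fderiv ℝ).comp_left (g := fun A : RN N →L[ℝ] ℝ => A (EuclideanSpace.single i (1 : ℝ))) rfl
  have hVd : ∀ i, Continuous fun x => fderiv ℝ (fun x => V x i) x (EuclideanSpace.single i 1) :=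
    fun i => ((hVi i).continuous_fderiv (by simp)).clm_apply continuous_const
  have i1 : ∀ i, Integrable fun x => fderiv ℝ (fun x => V x i) x (EuclideanSpace.single i 1) * w x :=
    fun i => ((hVd i).mul hw.continuous).integrable_of_hasCompactSupport hwc.mul_left
  have i2 : ∀ i, Integrable fun x => V x i * fderiv ℝ w x (EuclideanSpace.single i 1) :=
    fun i => ((hVi i).continuous.mul (hwd i)).integrable_of_hasCompactSupport (hws i).mul_left
  have i3 : ∀ i, Integrable fun x => V x i * w x :=
    fun i => ((hVi i).continuous.mul hw.continuous).integrable_of_hasCompactSupport hwc.mul_left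
  have e1 : ∀ x, inner ℝ (V x) (gradient w x) =
      ∑ i, V x i * fderiv ℝ w x (EuclideanSpace.single i 1) := by
    intro x
    rw [PiLp.inner_apply]
    refine Finset.sum_congr rfl fun i _ => ?_
    rw [gradient_apply, pderiv]
    simp only [RCLike.inner_apply, conj_trivial]
    ring
  simp_rw [e1, divergence, Finset.sum_mul, ← hder]
  rw [integral_finsetSum _ fun i _ => i2 i, integral_finsetSum _ fun i _ => i1 i,
    ← Finset.sum_neg_distrib]
  refine Finset.sum_congr rfl fun i _ => ?_
  exact integral_mul_fderiv_eq_neg_fderiv_mul_of_integrable (i1 i) (i2 i) (i3 i)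
    (fun x _ => (hVi i).differentiable (by simp) x) (fun x _ => hw.differentiable (by simp) x)

/-- A smooth substitute for (a multiple of) the positive part. -/
lemma exists_smooth_positive_part : ∃ F : ℝ → ℝ, ContDiff ℝ ∞ F ∧ (∀ t ≤ 0, F t = 0) ∧
    (∀ t, 0 < t → 0 < F t) ∧ Monotone F ∧ ∀ t, 0 ≤ deriv F t ∧ deriv F t ≤ 1 := by
  have hs : ContDiff ℝ ∞ Real.smoothTransition := Real.smoothTransition.contDiff
  obtain ⟨M, hM⟩ := (isCompact_Icc (a := (0 : ℝ)) (b := 1)).exists_bound_of_continuousOn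
    (hs.continuous_deriv (by simp)).continuousOn
  have hM' : ∀ t, deriv Real.smoothTransition t ≤ |M| + 1 := by
    intro t
    have hM1 := le_abs_self M
    by_cases ht : t ∈ Icc (0 : ℝ) 1
    · have := (le_abs_self _).trans (hM t ht)
      linarith
    · have : deriv Real.smoothTransition t = 0 := by
        rcases not_and_or.1 ht with h | h
        · have : Real.smoothTransition =ᶠ[𝓝 t] fun _ => (0 : ℝ) := by
            filter_upwards [Iio_mem_nhds (not_le.1 h)] with s hs
            exact Real.smoothTransition.zero_of_nonpos (le_of_lt hs)
          rw [this.deriv_eq]; simp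
        · have : Real.smoothTransition =ᶠ[𝓝 t] fun _ => (1 : ℝ) := by
            filter_upwards [Ioi_mem_nhds (not_le.1 h)] with s hs
            exact Real.smoothTransition.one_of_one_le (le_of_lt hs)
          rw [this.deriv_eq]; simp
      rw [this]
      positivity
  have hc : 0 < (|M| + 1)⁻¹ := by positivity
  refine ⟨fun t => (|M| + 1)⁻¹ * Real.smoothTransition t, contDiff_const.mul hs, fun t ht => ?_,
    fun t ht => ?_, fun s t hst => ?_, fun t => ?_⟩
  · simp [Real.smoothTransition.zero_of_nonpos ht]
  · exact mul_pos hc (Real.smoothTransition.pos_of_pos ht)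
  · exact mul_le_mul_of_nonneg_left (Real.smoothTransition.monotone hst) hc.le
  · rw [deriv_const_mul _ (hs.differentiable (by simp) t)]
    have h0 : 0 ≤ deriv Real.smoothTransition t := Real.smoothTransition.monotone.deriv_nonneg
    exact ⟨by positivity, (inv_mul_le_one₀ (by positivity)).2 (hM' t)⟩

/-- Pushing a test function `φ` towards a smooth `ψ` on the part of a ball where `ψ > φ` changes the
`p`-energy at most by the integral of the `p`-Laplacian of `ψ` against the perturbation. -/
lemma IsTestFunction.energy_add_le {φ ψ : RN N → ℝ} (hφ : IsTestFunction Ω φ)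
    (hψ : ContDiff ℝ ∞ ψ) (hp : 3 < p) {F : ℝ → ℝ} (hF : ContDiff ℝ ∞ F) (hF0 : ∀ t ≤ 0, F t = 0)
    (hF' : ∀ t, 0 ≤ deriv F t ∧ deriv F t ≤ 1) {x₀ : RN N} {r : ℝ} (hr : 0 < r)
    (hrΩ : Metric.ball x₀ r ⊆ Ω) (hlt : ∀ x ∈ Metric.ball x₀ r, r / 2 ≤ dist x x₀ → ψ x ≤ φ x)
    {w : RN N → ℝ} (hw : w = (Metric.ball x₀ r).indicator fun x => F (ψ x - φ x)) :
    IsTestFunction Ω w ∧ ∫ x in Ω, ‖gradient (φ + w) x‖ ^ p ≤ (∫ x in Ω, ‖gradient φ x‖ ^ p) -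
      p * ∫ x, divergence (fun y => ‖gradient ψ y‖ ^ (p - 2) • gradient ψ y) x * w x := by
  have hin : ∀ x ∈ Metric.ball x₀ r, w =ᶠ[𝓝 x] fun x => F (ψ x - φ x) := by
    intro x hx
    filter_upwards [Metric.isOpen_ball.mem_nhds hx] with y hy
    rw [hw, indicator_of_mem hy]
  have hzero : ∀ x ∉ Metric.ball x₀ (r / 2), w x = 0 := by
    intro x hx
    rw [hw]
    by_cases hxr : x ∈ Metric.ball x₀ r
    · rw [indicator_of_mem hxr]
      exact hF0 _ (sub_nonpos.2 (hlt x hxr (by simpa using hx)))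
    · rw [indicator_of_notMem hxr]
  have hout : ∀ x ∉ Metric.closedBall x₀ (r / 2), w =ᶠ[𝓝 x] fun _ => 0 := by
    intro x hx
    filter_upwards [Metric.isClosed_closedBall.isOpen_compl.mem_nhds hx] with y hy
    exact hzero y fun hy' => hy (Metric.ball_subset_closedBall hy')
  have hsub : Metric.closedBall x₀ (r / 2) ⊆ Metric.ball x₀ r :=
    Metric.closedBall_subset_ball (by linarith)
  have hts : tsupport w ⊆ Metric.closedBall x₀ (r / 2) :=
    closure_minimal (fun x hx => by
      by_contra hx'
      exact hx (hzero x fun h => hx' (Metric.ball_subset_closedBall h))) Metric.isClosed_closedBall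
  have hFψ : ContDiff ℝ ∞ fun x => F (ψ x - φ x) := hF.comp (hψ.sub hφ.1)
  have hwT : IsTestFunction Ω w := by
    refine ⟨contDiff_iff_contDiffAt.2 fun x => ?_, ?_, hts.trans (hsub.trans hrΩ)⟩
    · by_cases hx : x ∈ Metric.closedBall x₀ (r / 2)
      · exact hFψ.contDiffAt.congr_of_eventuallyEq (hin x (hsub hx))
      · exact contDiffAt_const.congr_of_eventuallyEq (hout x hx)
    · exact (isCompact_closedBall x₀ (r / 2)).of_isClosed_subset (isClosed_tsupport w) hts
  refine ⟨hwT, ?_⟩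
  set V : RN N → RN N := fun y => ‖gradient ψ y‖ ^ (p - 2) • gradient ψ y with hV
  have hψg : ContDiff ℝ 1 (gradient ψ) := by
    refine (InnerProductSpace.toDual ℝ (RN N)).symm.contDiff.comp ?_
    exact hψ.fderiv_right (m := 1) (by norm_cast)
  have hVC : ContDiff ℝ 1 V :=
    ((contDiff_norm_rpow (by linarith : (1 : ℝ) < p - 2)).comp hψg).smul hψg
  -- The gradient of the perturbation, valid on the whole space.
  have hgw : ∀ x, ∃ θ : ℝ, 0 ≤ θ ∧ θ ≤ 1 ∧ gradient w x = θ • (gradient ψ x - gradient φ x) := by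
    intro x
    by_cases hx : x ∈ Metric.closedBall x₀ (r / 2)
    · refine ⟨deriv F (ψ x - φ x), (hF' _).1, (hF' _).2, ?_⟩
      have hd : DifferentiableAt ℝ (ψ - φ) x :=
        (hψ.differentiable (by simp) x).sub (hφ.differentiable x)
      have h1 : HasFDerivAt (fun x => F ((ψ - φ) x)) (deriv F ((ψ - φ) x) • fderiv ℝ (ψ - φ) x) x :=
        (hF.differentiable (by simp) _).hasDerivAt.comp_hasFDerivAt x hd.hasFDerivAt
      have h2 : fderiv ℝ w x = deriv F (ψ x - φ x) • fderiv ℝ (ψ - φ) x := by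
        rw [(hin x (hsub hx)).fderiv_eq]
        exact h1.fderiv
      rw [← gradient_sub_apply (hψ.differentiable (by simp) x) (hφ.differentiable x)]
      simp only [gradient, h2, map_smul]
    · refine ⟨0, le_rfl, zero_le_one, ?_⟩
      rw [zero_smul, gradient, (hout x hx).fderiv_eq]
      simp
  have hpt : ∀ x, ‖gradient (φ + w) x‖ ^ p ≤
      ‖gradient φ x‖ ^ p + p * inner ℝ (V x) (gradient w x) := by
    intro x
    obtain ⟨θ, h0, h1, hθ⟩ := hgw x
    have hadd : gradient (φ + w) x = (1 - θ) • gradient φ x + θ • gradient ψ x := by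
      have : gradient (φ + w) x = gradient φ x + gradient w x := by
        simp only [gradient, fderiv_add (hφ.differentiable x) (hwT.differentiable x), map_add]
      rw [this, hθ]
      module
    have hconv : ‖gradient (φ + w) x‖ ^ p ≤
        (1 - θ) * ‖gradient φ x‖ ^ p + θ * ‖gradient ψ x‖ ^ p := by
      rw [hadd]
      refine (Real.rpow_le_rpow (norm_nonneg _) (norm_add_le _ _) (by linarith)).trans ?_
      rw [norm_smul, norm_smul, Real.norm_of_nonneg h0, Real.norm_of_nonneg (sub_nonneg.2 h1)]
      exact (convexOn_rpow (by linarith : 1 ≤ p)).2 (norm_nonneg (gradient φ x))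
        (norm_nonneg (gradient ψ x)) (sub_nonneg.2 h1) h0 (by ring)
    have htan := norm_rpow_sub_le (by linarith : 2 < p) (gradient φ x) (gradient ψ x)
    have h3 : p * inner ℝ (V x) (gradient w x) =
        θ * (p * inner ℝ (V x) (gradient ψ x - gradient φ x)) := by
      rw [hθ, real_inner_smul_right]
      ring
    rw [h3]
    have := mul_le_mul_of_nonneg_left htan h0
    simp only [hV]
    linarith
  have hcg : ∀ {f : RN N → ℝ}, IsTestFunction Ω f → Integrable fun x => ‖gradient f x‖ ^ p := by
    intro f hf
    refine Continuous.integrable_of_hasCompactSupport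
      ((continuous_gradient hf.contDiff_one).norm.rpow_const fun _ => Or.inr (by linarith))
      (hf.hasCompactSupport_gradient.comp_left (g := fun y => ‖y‖ ^ p) ?_)
    simp [Real.zero_rpow (by linarith : p ≠ 0)]
  have hwi : Integrable fun x => inner ℝ (V x) (gradient w x) :=
    Continuous.integrable_of_hasCompactSupport
      (hVC.continuous.inner (continuous_gradient hwT.contDiff_one))
      (hwT.hasCompactSupport_gradient.mono fun x hx => by
        contrapose! hx
        simp only [Function.mem_support, not_not] at hx ⊢
        rw [hx, inner_zero_right])
  have hibp := integral_inner_gradient hVC hwT.contDiff_one hwT.2.1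
  calc ∫ x in Ω, ‖gradient (φ + w) x‖ ^ p
      ≤ ∫ x in Ω, (‖gradient φ x‖ ^ p + p * inner ℝ (V x) (gradient w x)) :=
        integral_mono (hcg (hφ.add hwT)).integrableOn
          ((hcg hφ).integrableOn.add (hwi.integrableOn.const_mul p)) hpt
    _ = (∫ x in Ω, ‖gradient φ x‖ ^ p) + p * ∫ x in Ω, inner ℝ (V x) (gradient w x) := by
        rw [integral_add (hcg hφ).integrableOn (hwi.integrableOn.const_mul p), integral_const_mul]
    _ = _ := by
        have hset : ∫ x in Ω, inner ℝ (V x) (gradient w x) = ∫ x, inner ℝ (V x) (gradient w x) :=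
          setIntegral_eq_integral_of_forall_compl_eq_zero fun x hx => by
            rw [hwT.gradient_eq_zero hx, inner_zero_right]
        rw [hset, hibp]
        ring

/-- A minimizer of the Sobolev quotient cannot be crossed from below, in the interior of a ball, by
a strictly `p`-subharmonic function. The minimizer enters only through test functions that
approximate it. -/
theorem false_of_touching_below {v : RN N → ℝ} {φ : ℕ → RN N → ℝ}
    (hΩ : IsOpen Ω) (hΩb : Bornology.IsBounded Ω)
    (hφ : ∀ k, IsTestFunction Ω (φ k)) (hv : TendstoUniformly φ v atTop) (hvc : Continuous v)
    (hv0 : ∀ x ∈ Ω, 0 ≤ v x)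
    (hp : 3 < p) (hq : 0 < q) (hv1 : ∫ x in Ω, |v x| ^ q = 1)
    (hI : Tendsto (fun k => ∫ x in Ω, ‖gradient (φ k) x‖ ^ p) atTop (𝓝 (sobolevConst Ω p q)))
    {ψ : RN N → ℝ} (hψ : ContDiff ℝ ∞ ψ) {x₀ : RN N} {r m : ℝ} (hr : 0 < r)
    (hrΩ : Metric.ball x₀ r ⊆ Ω) (hm : 0 < m)
    (hlt : ∀ x ∈ Metric.ball x₀ r, r / 2 ≤ dist x x₀ → ψ x + m ≤ v x) (hx₀ : v x₀ < ψ x₀)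
    (hdiv : ∀ x ∈ Metric.ball x₀ r,
      0 < divergence (fun y => ‖gradient ψ y‖ ^ (p - 2) • gradient ψ y) x) : False := by
  obtain ⟨F, hF, hF0, hFpos, hFmono, hF'⟩ := exists_smooth_positive_part
  set D := divergence (fun y => ‖gradient ψ y‖ ^ (p - 2) • gradient ψ y) with hD
  have hψg : ContDiff ℝ 1 (gradient ψ) := by
    refine (InnerProductSpace.toDual ℝ (RN N)).symm.contDiff.comp ?_
    exact hψ.fderiv_right (m := 1) (by norm_cast)
  have hDc : Continuous D := continuous_divergence
    (((contDiff_norm_rpow (by linarith : (1 : ℝ) < p - 2)).comp hψg).smul hψg)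
  set w : ℕ → RN N → ℝ := fun k => (Metric.ball x₀ r).indicator fun x => F (ψ x - φ k x) with hw
  have hFnn : ∀ t, 0 ≤ F t := fun t => by
    rcases le_or_gt t 0 with ht | ht
    · exact (hF0 t ht).ge
    · exact (hFpos t ht).le
  have hwnn : ∀ k x, 0 ≤ w k x := fun k x => indicator_nonneg (fun _ _ => hFnn _) x
  -- A ball on which `ψ` exceeds the minimizer by a fixed amount.
  set m' := (ψ x₀ - v x₀) / 4 with hm'
  have hm'0 : 0 < m' := by
    have : 0 < ψ x₀ - v x₀ := by linarith
    positivity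
  obtain ⟨ρ, hρ0, hρr, hρ⟩ : ∃ ρ > 0, ρ < r ∧ ∀ x ∈ Metric.ball x₀ ρ, 2 * m' < ψ x - v x := by
    have hc : ContinuousAt (fun x => ψ x - v x) x₀ := by
      have := hψ.continuous
      fun_prop
    have : ∀ᶠ x in 𝓝 x₀, 2 * m' < ψ x - v x :=
      hc.eventually (lt_mem_nhds (by rw [hm']; linarith))
    obtain ⟨ρ, hρ0, hρ⟩ := Metric.eventually_nhds_iff_ball.1 this
    exact ⟨min ρ (r / 2), by positivity, (min_le_right _ _).trans_lt (by linarith), fun x hx =>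
      hρ x (Metric.ball_subset_ball (min_le_left _ _) hx)⟩
  have hρsub : Metric.ball x₀ ρ ⊆ Metric.ball x₀ r := Metric.ball_subset_ball hρr.le
  have hDi : IntegrableOn D (Metric.ball x₀ ρ) :=
    (hDc.continuousOn.integrableOn_compact (isCompact_closedBall x₀ ρ)).mono_set
      Metric.ball_subset_closedBall
  have hDpos : 0 < ∫ x in Metric.ball x₀ ρ, D x := by
    rw [setIntegral_pos_iff_support_of_nonneg_ae _ hDi]
    · refine (Metric.measure_ball_pos volume x₀ hρ0).trans_le (measure_mono fun x hx => ?_)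
      exact ⟨(hdiv x (hρsub hx)).ne', hx⟩
    · filter_upwards [ae_restrict_mem measurableSet_ball] with x hx using (hdiv x (hρsub hx)).le
  set c := F m' * ∫ x in Metric.ball x₀ ρ, D x with hc
  have hcpos : 0 < c := mul_pos (hFpos m' hm'0) hDpos
  -- The perturbation lowers the energy of `φ k` by an amount independent of `k`.
  have hclose : ∀ᶠ k in atTop, ∀ x, |v x - φ k x| < min m m' := by
    have := Metric.tendstoUniformly_iff.1 hv (min m m') (lt_min hm hm'0)
    simpa [Real.dist_eq] using this
  have hstep : ∀ᶠ k in atTop, sobolevConst Ω p q * (∫ x in Ω, (max (φ k x) 0) ^ q) ^ (p / q) ≤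
      (∫ x in Ω, ‖gradient (φ k) x‖ ^ p) - p * c := by
    filter_upwards [hclose] with k hk
    have hlt' : ∀ x ∈ Metric.ball x₀ r, r / 2 ≤ dist x x₀ → ψ x ≤ φ k x := by
      intro x hx hx'
      have h1 := hlt x hx hx'
      have h2 := (abs_lt.1 ((hk x).trans_le (min_le_left _ _))).2
      linarith
    obtain ⟨hwT, hen⟩ := (hφ k).energy_add_le hψ hp hF hF0 hF' hr hrΩ hlt' (w := w k) rfl
    have hvT := (hφ k).add hwT
    have h1 := hvT.sobolevConst_mul_le hΩ hΩb (by linarith : 0 < p) hq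
    have hqi : ∀ {f : RN N → ℝ}, IsTestFunction Ω f → Integrable fun x => |f x| ^ q := by
      intro f hf
      refine Continuous.integrable_of_hasCompactSupport
        (hf.1.continuous.abs.rpow_const fun _ => Or.inr hq.le)
        (hf.2.1.comp_left (g := fun t => |t| ^ q) ?_)
      simp [Real.zero_rpow hq.ne']
    have h2 : ∫ x in Ω, (max (φ k x) 0) ^ q ≤ ∫ x in Ω, |(φ k + w k) x| ^ q := by
      refine integral_mono_of_nonneg (.of_forall fun x => by positivity) (hqi hvT).integrableOn
        (.of_forall fun x => Real.rpow_le_rpow (le_max_right _ _) (max_le ?_ (abs_nonneg _)) hq.le)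
      refine le_trans ?_ (le_abs_self _)
      have := hwnn k x
      rw [Pi.add_apply]
      linarith
    have h3 : c ≤ ∫ x, D x * w k x := by
      have hDw : ∀ x, 0 ≤ D x * w k x := by
        intro x
        by_cases hx : x ∈ Metric.ball x₀ r
        · exact mul_nonneg (hdiv x hx).le (hwnn k x)
        · simp [hw, hx]
      have hDwi : Integrable fun x => D x * w k x :=
        (hDc.mul hwT.1.continuous).integrable_of_hasCompactSupport hwT.2.1.mul_left
      calc c = ∫ x in Metric.ball x₀ ρ, D x * F m' := by rw [hc, integral_mul_const, mul_comm]
        _ ≤ ∫ x in Metric.ball x₀ ρ, D x * w k x := by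
          refine setIntegral_mono_on (hDi.mul_const _) hDwi.integrableOn measurableSet_ball
            fun x hx => mul_le_mul_of_nonneg_left ?_ (hdiv x (hρsub hx)).le
          simp only [hw]
          rw [indicator_of_mem (hρsub hx)]
          refine hFmono ?_
          have h4 := hρ x hx
          have h5 := (abs_lt.1 ((hk x).trans_le (min_le_right _ _))).1
          linarith
        _ ≤ ∫ x, D x * w k x := setIntegral_le_integral hDwi (.of_forall hDw)
    calc sobolevConst Ω p q * (∫ x in Ω, (max (φ k x) 0) ^ q) ^ (p / q)
        ≤ sobolevConst Ω p q * (∫ x in Ω, |(φ k + w k) x| ^ q) ^ (p / q) := by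
          refine mul_le_mul_of_nonneg_left (Real.rpow_le_rpow ?_ h2 ?_) sobolevConst_nonneg
          · exact integral_nonneg fun x => by positivity
          · have : 0 < p := by linarith
            positivity
      _ ≤ _ := h1.trans hen
      _ ≤ _ := by
          have : p * c ≤ p * ∫ x, D x * w k x := mul_le_mul_of_nonneg_left h3 (by linarith)
          linarith
  -- In the limit `k → ∞` the energy of the minimizer itself would be smaller than it is.
  have hlimJ : Tendsto (fun k => ∫ x in Ω, (max (φ k x) 0) ^ q) atTop (𝓝 1) := by
    obtain ⟨M, hM⟩ := hΩb.isCompact_closure.exists_bound_of_continuousOn hvc.continuousOn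
    rw [← hv1]
    refine tendsto_integral_filter_of_dominated_convergence (fun _ => (|M| + m) ^ q)
      (.of_forall fun k => ?_) ?_ ?_ ?_
    · exact (((hφ k).1.continuous.max continuous_const).rpow_const
        fun _ => Or.inr hq.le).aestronglyMeasurable
    · filter_upwards [hclose] with k hk
      filter_upwards [ae_restrict_mem hΩ.measurableSet] with x hx
      rw [Real.norm_of_nonneg (by positivity)]
      refine Real.rpow_le_rpow (le_max_right _ _) (max_le ?_ (by positivity)) hq.le
      have h1 := hM x (subset_closure hx)
      have h2 := (abs_lt.1 ((hk x).trans_le (min_le_left _ _))).1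
      have h3 := (le_abs_self (v x)).trans (h1.trans (le_abs_self M))
      linarith
    · exact integrableOn_const hΩb.measure_lt_top.ne
    · filter_upwards [ae_restrict_mem hΩ.measurableSet] with x hx
      have h1 : Tendsto (fun k => max (φ k x) 0) atTop (𝓝 (max (v x) 0)) :=
        (hv.tendsto_at x).max tendsto_const_nhds
      rw [max_eq_left (hv0 x hx)] at h1
      rw [abs_of_nonneg (hv0 x hx)]
      exact h1.rpow_const (Or.inr hq.le)
  have hlim := le_of_tendsto_of_tendsto
    ((hlimJ.rpow_const (p := p / q) (Or.inl one_ne_zero)).const_mul (sobolevConst Ω p q))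
    (hI.sub_const (p * c)) hstep
  rw [Real.one_rpow, mul_one] at hlim
  have : 0 < p * c := mul_pos (by linarith) hcpos
  linarith

end

/-! ### Infinity superharmonicity tested with quadratic polynomials -/

section
variable {N : ℕ} {Ω : Set (RN N)}

/-- The quadratic polynomial with value `c`, gradient `b` and Hessian `A` at `x₀`. -/
noncomputable def quadPoly (c : ℝ) (b : RN N) (A : RN N →L[ℝ] RN N) (x₀ x : RN N) : ℝ :=
  c + inner ℝ b (x - x₀) + 1 / 2 * inner ℝ (A (x - x₀)) (x - x₀)

/-- `u` is infinity superharmonic in `D` in the viscosity sense, tested with quadratic polynomials: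
one that touches `u` from below at `x₀`, not necessarily strictly, has nonpositive infinity
Laplacian `⟪A b, b⟫` at `x₀`. -/
def IsQuadSuper (D : Set (RN N)) (u : RN N → ℝ) : Prop :=
  ∀ x₀ ∈ D, ∀ (b : RN N) (A : RN N →L[ℝ] RN N), (∀ x y, inner ℝ (A x) y = inner ℝ x (A y)) →
    (∀ᶠ x in 𝓝 x₀, quadPoly (u x₀) b A x₀ x ≤ u x) → inner ℝ (A b) b ≤ 0

lemma quadPoly_sub_smul_id (c : ℝ) (b : RN N) (A : RN N →L[ℝ] RN N) (δ : ℝ) (x₀ x : RN N) :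
    quadPoly c b (A - (2 * δ) • ContinuousLinearMap.id ℝ (RN N)) x₀ x =
      quadPoly c b A x₀ x - δ * ‖x - x₀‖ ^ 2 := by
  unfold quadPoly
  generalize x - x₀ = z
  simp only [sub_apply, smul_apply, ContinuousLinearMap.id_apply, inner_sub_left,
    real_inner_smul_left, real_inner_self_eq_norm_sq]
  ring

lemma contDiff_quadPoly (c : ℝ) (b : RN N) (A : RN N →L[ℝ] RN N) (x₀ : RN N) :
    ContDiff ℝ ∞ (quadPoly c b A x₀) := by
  unfold quadPoly
  have h1 : ContDiff ℝ ∞ fun x : RN N => x - x₀ := contDiff_id.sub contDiff_const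
  exact (contDiff_const.add (contDiff_const.inner ℝ h1)).add
    (contDiff_const.mul ((A.contDiff.comp h1).inner ℝ h1))

lemma gradient_quadPoly (c : ℝ) (b : RN N) {A : RN N →L[ℝ] RN N}
    (hA : ∀ x y, inner ℝ (A x) y = inner ℝ x (A y)) (x₀ x : RN N) :
    gradient (quadPoly c b A x₀) x = b + A (x - x₀) := by
  refine HasGradientAt.gradient ?_
  rw [hasGradientAt_iff_hasFDerivAt]
  have h1 : HasFDerivAt (fun x : RN N => x - x₀) (ContinuousLinearMap.id ℝ (RN N)) x :=
    (hasFDerivAt_id x).sub_const x₀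
  have h2 := (((hasFDerivAt_const b x).inner ℝ h1).const_add c).add
    (((A.hasFDerivAt.comp x h1).inner ℝ h1).const_mul (1 / 2))
  refine h2.congr_fderiv ?_
  ext v
  simp [fderivInnerCLM_apply, hA v]
  rw [real_inner_comm (A x - A x₀) v, inner_sub_left]
  ring

/-- The `p`-Laplacian of a quadratic polynomial. -/
lemma divergence_norm_rpow_smul {p : ℝ} (hp : 3 < p) (b : RN N) (A : RN N →L[ℝ] RN N)
    (x₀ x : RN N) :
    divergence (fun y => ‖b + A (y - x₀)‖ ^ (p - 2) • (b + A (y - x₀))) x =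
      ‖b + A (x - x₀)‖ ^ (p - 2) * (∑ i, A (EuclideanSpace.single i 1) i) +
        (p - 2) * ‖b + A (x - x₀)‖ ^ (p - 4) *
          inner ℝ (A (b + A (x - x₀))) (b + A (x - x₀)) := by
  set W := b + A (x - x₀) with hW
  have h1 : HasFDerivAt (fun y => b + A (y - x₀)) A x := by
    have : HasFDerivAt (fun x : RN N => x - x₀) (ContinuousLinearMap.id ℝ (RN N)) x :=
      (hasFDerivAt_id x).sub_const x₀
    exact (A.hasFDerivAt.comp x this).const_add b
  have h2 := (hasFDerivAt_norm_rpow W (by linarith : 1 < p - 2)).comp x h1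
  have h3 := h2.smul h1
  have h4 : ∀ v, fderiv ℝ (fun y => ‖b + A (y - x₀)‖ ^ (p - 2) • (b + A (y - x₀))) x v =
      ‖W‖ ^ (p - 2) • A v + ((p - 2) * ‖W‖ ^ (p - 4) * inner ℝ W (A v)) • W := by
    intro v
    rw [show fderiv ℝ (fun y => ‖b + A (y - x₀)‖ ^ (p - 2) • (b + A (y - x₀))) x = _ from h3.fderiv]
    change ‖W‖ ^ (p - 2) • A v + ((p - 2) * ‖W‖ ^ (p - 2 - 2) * inner ℝ W (A v)) • W = _
    rw [show p - 2 - 2 = p - 4 by ring]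
  have hAW : A W = ∑ i, W i • A (EuclideanSpace.single i 1) := by
    conv_lhs => rw [← (EuclideanSpace.basisFun (Fin N) ℝ).sum_repr W]
    simp
  rw [divergence]
  simp_rw [h4]
  simp only [PiLp.add_apply, PiLp.smul_apply, smul_eq_mul, Finset.sum_add_distrib]
  rw [← Finset.mul_sum]
  congr 1
  rw [hAW, sum_inner, Finset.mul_sum]
  refine Finset.sum_congr rfl fun i _ => ?_
  rw [real_inner_smul_left, real_inner_comm]
  ring

/-- Infinity superharmonicity passes to uniform limits of functions that admit no crossing from
below by strictly `p`-subharmonic functions, `p → ∞`: for a polynomial with `⟪A b, b⟫ > 0`, the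
infinity Laplacian dominates the `p`-Laplacian for large `p`. -/
theorem isQuadSuper_of_tendstoUniformly {v : ℕ → RN N → ℝ} {u : RN N → ℝ} {p : ℕ → ℝ}
    (hΩ : IsOpen Ω) (hp : Tendsto p atTop atTop) (hv : TendstoUniformly v u atTop)
    (hcmp : ∀ᶠ n in atTop, ∀ ψ : RN N → ℝ, ContDiff ℝ ∞ ψ → ∀ (x₀ : RN N) (r m : ℝ), 0 < r →
      Metric.ball x₀ r ⊆ Ω → 0 < m →
      (∀ x ∈ Metric.ball x₀ r, r / 2 ≤ dist x x₀ → ψ x + m ≤ v n x) → v n x₀ < ψ x₀ →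
      (∀ x ∈ Metric.ball x₀ r,
        0 < divergence (fun y => ‖gradient ψ y‖ ^ (p n - 2) • gradient ψ y) x) → False) :
    IsQuadSuper Ω u := by
  intro x₀ hx₀ b A hA htouch
  by_contra! hpos
  -- Lowering the Hessian makes the contact strict.
  obtain ⟨δ, hδ, hδA⟩ : ∃ δ > 0, 0 < inner ℝ (A b) b - 2 * δ * ‖b‖ ^ 2 := by
    refine ⟨inner ℝ (A b) b / (2 * (2 * ‖b‖ ^ 2 + 1)), by positivity, ?_⟩
    have h1 : 2 * (inner ℝ (A b) b / (2 * (2 * ‖b‖ ^ 2 + 1))) * ‖b‖ ^ 2 * (2 * ‖b‖ ^ 2 + 1) =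
        inner ℝ (A b) b * ‖b‖ ^ 2 := by field_simp
    nlinarith [sq_nonneg ‖b‖]
  set A' : RN N →L[ℝ] RN N := A - (2 * δ) • ContinuousLinearMap.id ℝ (RN N) with hA'd
  have hA'v : ∀ x, A' x = A x - (2 * δ) • x := fun x => by simp [hA'd]
  have hA' : ∀ x y, inner ℝ (A' x) y = inner ℝ x (A' y) := fun x y => by
    rw [hA'v, hA'v, inner_sub_left, inner_sub_right, hA, real_inner_smul_left,
      real_inner_smul_right]
  set W : RN N → RN N := fun x => b + A' (x - x₀) with hW
  have hWc : Continuous W := by fun_prop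
  have hposW : ∀ᶠ x in 𝓝 x₀, 0 < inner ℝ (A' (W x)) (W x) := by
    have hc : Continuous fun x => inner ℝ (A' (W x)) (W x) :=
      (A'.continuous.comp hWc).inner hWc
    refine hc.continuousAt.eventually (lt_mem_nhds ?_)
    have : W x₀ = b := by simp [hW]
    change 0 < inner ℝ (A' (W x₀)) (W x₀)
    rw [this, hA'v, inner_sub_left, real_inner_smul_left, real_inner_self_eq_norm_sq]
    exact hδA
  obtain ⟨s, hs, hball⟩ := Metric.eventually_nhds_iff_ball.1
    (htouch.and (hposW.and (hΩ.eventually_mem hx₀)))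
  set r := s / 2 with hr
  have hr0 : 0 < r := by positivity
  have hrs : Metric.closedBall x₀ r ⊆ Metric.ball x₀ s :=
    Metric.closedBall_subset_ball (by linarith)
  have hrb : Metric.ball x₀ r ⊆ Metric.ball x₀ s := Metric.ball_subset_closedBall.trans hrs
  -- On the compact ball the infinity Laplacian is bounded below and the Laplacian term is bounded.
  set T := ∑ i, A' (EuclideanSpace.single i 1) i with hT
  obtain ⟨y, hy, hymin⟩ := (isCompact_closedBall x₀ r).exists_isMinOn ⟨x₀, by simp [hr0.le]⟩
    ((A'.continuous.comp hWc).inner (𝕜 := ℝ) hWc).continuousOn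
  set c₀ := inner ℝ (A' (W y)) (W y) with hc₀
  have hc₀pos : 0 < c₀ := (hball y (hrs hy)).2.1
  obtain ⟨M, hM⟩ := (isCompact_closedBall x₀ r).exists_bound_of_continuousOn hWc.continuousOn
  set m := δ * (r / 2) ^ 2 / 4 with hm
  have hm0 : 0 < m := by positivity
  have hlarge : ∀ᶠ n in atTop, 4 < p n ∧ M ^ 2 * |T| < (p n - 2) * c₀ := by
    refine (hp.eventually_gt_atTop 4).and ?_
    filter_upwards [hp.eventually_gt_atTop (M ^ 2 * |T| / c₀ + 2)] with n hn
    rw [← div_lt_iff₀ hc₀pos]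
    linarith
  have hclose : ∀ᶠ n in atTop, ∀ x, |u x - v n x| < m := by
    simpa [Real.dist_eq] using Metric.tendstoUniformly_iff.1 hv m hm0
  obtain ⟨n, hn, ⟨hp4, hpT⟩, hnc⟩ := (hcmp.and (hlarge.and hclose)).exists
  refine hn (quadPoly (u x₀ + 2 * m) b A' x₀) (contDiff_quadPoly _ _ _ _) x₀ r m hr0
    (fun x hx => (hball x (hrb hx)).2.2) hm0 (fun x hx hx2 => ?_) ?_ (fun x hx => ?_)
  · have h1 := (hball x (hrb hx)).1
    have h2 := (abs_lt.1 (hnc x)).2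
    have h3 : quadPoly (u x₀ + 2 * m) b A' x₀ x = quadPoly (u x₀) b A x₀ x + 2 * m -
        δ * ‖x - x₀‖ ^ 2 := by
      rw [hA'd, quadPoly_sub_smul_id, quadPoly, quadPoly]
      ring
    have h4 : (r / 2) ^ 2 ≤ ‖x - x₀‖ ^ 2 := by
      rw [← dist_eq_norm]
      gcongr
    have h5 : δ * (r / 2) ^ 2 ≤ δ * ‖x - x₀‖ ^ 2 := by gcongr
    have h6 : δ * (r / 2) ^ 2 = 4 * m := by rw [hm]; ring
    linarith
  · have h2 := (abs_lt.1 (hnc x₀)).1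
    have h3 : quadPoly (u x₀ + 2 * m) b A' x₀ x₀ = u x₀ + 2 * m := by simp [quadPoly]
    rw [h3]
    linarith
  · simp_rw [gradient_quadPoly _ b hA']
    rw [divergence_norm_rpow_smul (by linarith) b A' x₀ x]
    change 0 < ‖W x‖ ^ (p n - 2) * T + (p n - 2) * ‖W x‖ ^ (p n - 4) * inner ℝ (A' (W x)) (W x)
    have hWx : W x ≠ 0 := by
      intro h0
      have := (hball x (hrb hx)).2.1
      rw [h0, inner_zero_right] at this
      exact lt_irrefl _ this
    have hWp : 0 < ‖W x‖ := norm_pos_iff.2 hWx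
    have hxc := Metric.ball_subset_closedBall hx
    have h1 : c₀ ≤ inner ℝ (A' (W x)) (W x) := hymin hxc
    have h2 : ‖W x‖ ^ 2 ≤ M ^ 2 := pow_le_pow_left₀ (norm_nonneg _) (hM x hxc) 2
    have h3 : ‖W x‖ ^ (p n - 2) = ‖W x‖ ^ (p n - 4) * ‖W x‖ ^ 2 := by
      rw [← Real.rpow_natCast, ← Real.rpow_add hWp]
      congr 1
      push_cast
      ring
    rw [h3]
    have h4 : 0 < ‖W x‖ ^ (p n - 4) := by positivity
    have h5 : -(M ^ 2 * |T|) ≤ ‖W x‖ ^ 2 * T := by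
      have h6 : ‖W x‖ ^ 2 * |T| ≤ M ^ 2 * |T| := by gcongr
      have h7 : ‖W x‖ ^ 2 * -|T| ≤ ‖W x‖ ^ 2 * T := by
        gcongr
        exact neg_abs_le T
      linarith
    have h8 : (p n - 2) * c₀ ≤ (p n - 2) * inner ℝ (A' (W x)) (W x) :=
      mul_le_mul_of_nonneg_left h1 (by linarith)
    have : 0 < ‖W x‖ ^ (p n - 4) * (‖W x‖ ^ 2 * T + (p n - 2) * inner ℝ (A' (W x)) (W x)) :=
      mul_pos h4 (by linarith)
    linarith

/-- The second-order Taylor formula, as a lower bound near `x₀`. -/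
lemma eventually_taylor_le {φ : RN N → ℝ} {x₀ : RN N} (hφ : ContDiffAt ℝ 2 φ x₀) {δ : ℝ}
    (hδ : 0 < δ) : ∀ᶠ x in 𝓝 x₀, φ x₀ + fderiv ℝ φ x₀ (x - x₀) +
      1 / 2 * fderiv ℝ (fderiv ℝ φ) x₀ (x - x₀) (x - x₀) - δ * ‖x - x₀‖ ^ 2 ≤ φ x := by
  set D := fderiv ℝ (fderiv ℝ φ) x₀ with hD
  have hsymm : ∀ v w, D v w = D w v := fun v w =>
    (hφ.isSymmSndFDerivAt (by simp)).eq v w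
  have hd : DifferentiableAt ℝ (fderiv ℝ φ) x₀ :=
    (hφ.fderiv_right (m := 1) (by norm_num)).differentiableAt (by simp)
  have h1 := hd.hasFDerivAt.isLittleO.def hδ
  have h2 : ∀ᶠ x in 𝓝 x₀, DifferentiableAt ℝ φ x := by
    filter_upwards [hφ.eventually (by simp)] with x hx using hx.differentiableAt (by simp)
  obtain ⟨s, hs, hball⟩ := Metric.eventually_nhds_iff_ball.1 (h1.and h2)
  filter_upwards [Metric.ball_mem_nhds x₀ hs] with x hx
  set R : RN N → ℝ := fun y => φ y - fderiv ℝ φ x₀ (y - x₀) - 1 / 2 * D (y - x₀) (y - x₀) with hR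
  have hsub : Metric.closedBall x₀ ‖x - x₀‖ ⊆ Metric.ball x₀ s :=
    Metric.closedBall_subset_ball (by rwa [← dist_eq_norm])
  have hRd : ∀ y ∈ Metric.closedBall x₀ ‖x - x₀‖,
      HasFDerivWithinAt R (fderiv ℝ φ y - fderiv ℝ φ x₀ - D (y - x₀))
        (Metric.closedBall x₀ ‖x - x₀‖) y := by
    intro y hy
    refine HasFDerivAt.hasFDerivWithinAt ?_
    have e1 : HasFDerivAt (fun x : RN N => x - x₀) (ContinuousLinearMap.id ℝ (RN N)) y :=
      (hasFDerivAt_id y).sub_const x₀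
    have e2 := ((fderiv ℝ φ x₀).hasFDerivAt (x := y - x₀)).comp y e1
    have e3 := ((D.hasFDerivAt (x := y - x₀)).comp y e1).clm_apply e1
    have e4 := ((hball y (hsub hy)).2.hasFDerivAt.sub e2).sub (e3.const_mul (1 / 2))
    refine e4.congr_fderiv ?_
    ext v
    simp
    rw [hsymm v y, hsymm v x₀]
    ring
  have hRb : ∀ y ∈ Metric.closedBall x₀ ‖x - x₀‖,
      ‖fderiv ℝ φ y - fderiv ℝ φ x₀ - D (y - x₀)‖ ≤ δ * ‖x - x₀‖ := by
    intro y hy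
    refine (hball y (hsub hy)).1.trans ?_
    gcongr
    rwa [← dist_eq_norm]
  have := (convex_closedBall x₀ ‖x - x₀‖).norm_image_sub_le_of_norm_hasFDerivWithin_le hRd hRb
    (Metric.mem_closedBall_self (norm_nonneg _)) (show x ∈ _ by simp [dist_eq_norm])
  have h3 := (abs_le.1 this).1
  simp only [hR, sub_self, map_zero, mul_zero, sub_zero] at h3
  have h4 : δ * ‖x - x₀‖ * ‖x - x₀‖ = δ * ‖x - x₀‖ ^ 2 := by ring
  linarith

/-- A `C²` test function lies above its second-order Taylor polynomial with slightly lowered Hessian,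
which therefore touches `u` from below as well. -/
lemma IsQuadSuper.isInfSuperharmonic {u : RN N → ℝ} (h : IsQuadSuper Ω u)
    (huc : ContinuousOn u Ω) : IsInfSuperharmonic Ω u := by
  refine ⟨huc, fun x₀ hx₀ r hr hrΩ φ hφ h0 hlt => ?_⟩
  have hφa : ContDiffAt ℝ 2 φ x₀ := hφ.contDiffAt (Metric.ball_mem_nhds x₀ hr)
  set D := fderiv ℝ (fderiv ℝ φ) x₀ with hD
  have hsymm : ∀ v w, D v w = D w v := fun v w =>
    (hφa.isSymmSndFDerivAt (by simp)).eq v w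
  have hd : DifferentiableAt ℝ (fderiv ℝ φ) x₀ :=
    (hφa.fderiv_right (m := 1) (by norm_num)).differentiableAt (by simp)
  set b := gradient φ x₀ with hb
  have hbv : ∀ v, inner ℝ b v = fderiv ℝ φ x₀ v := fun v => InnerProductSpace.toDual_symm_apply
  let A : RN N →L[ℝ] RN N := LinearMap.toContinuousLinearMap
    { toFun := fun v => (InnerProductSpace.toDual ℝ (RN N)).symm (D v)
      map_add' := fun v w => by rw [map_add, map_add]
      map_smul' := fun c v => by simp }
  have hAv : ∀ v w, inner ℝ (A v) w = D v w := fun v w => InnerProductSpace.toDual_symm_apply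
  have hlap : infLaplacian φ x₀ = inner ℝ (A b) b := by
    have hpd : ∀ i j, pderiv j (pderiv i φ) x₀ =
        D (EuclideanSpace.single j 1) (EuclideanSpace.single i 1) := by
      intro i j
      have e := hd.hasFDerivAt.clm_apply (hasFDerivAt_const (EuclideanSpace.single i (1 : ℝ)) x₀)
      rw [pderiv, show fderiv ℝ (pderiv i φ) x₀ = _ from e.fderiv]
      simp [hD]
    have hbs : b = ∑ i, b i • EuclideanSpace.single i (1 : ℝ) := by
      simpa using ((EuclideanSpace.basisFun (Fin N) ℝ).sum_repr b).symm
    have hbi : ∀ i, pderiv i φ x₀ = b i := fun i => (gradient_apply φ x₀ i).symm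
    have hDb : D b b = ∑ j, ∑ i, b j * (b i * D (EuclideanSpace.single j 1)
        (EuclideanSpace.single i 1)) := by
      conv_lhs => rw [hbs]
      simp only [map_sum, map_smul, sum_apply, smul_apply,
        smul_eq_mul, Finset.mul_sum]
      rw [Finset.sum_comm]
      refine Finset.sum_congr rfl fun i _ => Finset.sum_congr rfl fun j _ => ?_
      ring
    rw [hAv, hDb, infLaplacian, Finset.sum_comm]
    refine Finset.sum_congr rfl fun j _ => Finset.sum_congr rfl fun i _ => ?_
    rw [hpd, hbi, hbi]
    ring
  rw [hlap, neg_nonneg]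
  have key : ∀ δ > 0, inner ℝ (A b) b ≤ 2 * δ * ‖b‖ ^ 2 := by
    intro δ hδ
    have h1 := h x₀ hx₀ b (A - (2 * δ) • ContinuousLinearMap.id ℝ (RN N)) (fun x y => by
      simp only [sub_apply, smul_apply,
        ContinuousLinearMap.id_apply, inner_sub_left, inner_sub_right, real_inner_smul_left,
        real_inner_smul_right]
      rw [hAv, hsymm, ← hAv, real_inner_comm]) ?_
    · simp only [sub_apply, smul_apply,
        ContinuousLinearMap.id_apply, inner_sub_left, real_inner_smul_left,
        real_inner_self_eq_norm_sq] at h1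
      linarith
    · filter_upwards [eventually_taylor_le hφa hδ, Metric.ball_mem_nhds x₀ hr] with x hx hxr
      have hux : φ x ≤ u x := by
        rcases eq_or_ne x x₀ with rfl | hne
        · linarith
        · linarith [hlt x hxr hne]
      refine le_trans (le_trans (le_of_eq ?_) hx) hux
      rw [quadPoly_sub_smul_id, quadPoly, hAv, hbv, sub_eq_zero.1 h0]
  have hlim : Tendsto (fun δ : ℝ => 2 * δ * ‖b‖ ^ 2) (𝓝[>] 0) (𝓝 (2 * 0 * ‖b‖ ^ 2)) :=
    ((Continuous.tendsto (by fun_prop) _).mono_left nhdsWithin_le_nhds)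
  have := ge_of_tendsto hlim (by filter_upwards [self_mem_nhdsWithin] with δ hδ using key δ hδ)
  simpa using this

end

/-! ### Positivity of infinity superharmonic functions -/

section
variable {N : ℕ} {Ω : Set (RN N)}

/-- A lower bound for `1 / s - 1 / s₀`, where `s = |w + t|²`, `s₀ = |w|²`, `e = ⟪w, t⟫` and `z = |t|²`:
a quadratic polynomial in `t` whose Hessian in the direction `w` is still positive. -/
lemma inv_sub_inv_barrier {s s₀ e z : ℝ} (hs₀ : 0 < s₀) (hs : 0 < s) (hs' : s < 4 / 3 * s₀)
    (hz : 0 ≤ z) (hz' : z < 4 / 9 * s₀) (h : s = s₀ + (2 * e + z)) :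
    -(2 / s₀ ^ 2) * e + 1 / 2 * (9 / (2 * s₀ ^ 3) * e * e - 4 / s₀ ^ 2 * z) ≤ 1 / s - 1 / s₀ := by
  have h1 : 1 / s - 1 / s₀ = -(2 * e + z) / s₀ ^ 2 + (2 * e + z) ^ 2 / (s₀ ^ 2 * s) := by
    rw [show 2 * e + z = s - s₀ by linarith]
    field_simp
    ring
  have h2 : (2 * e + z) ^ 2 * (3 / (4 * s₀ ^ 3)) ≤ (2 * e + z) ^ 2 / (s₀ ^ 2 * s) := by
    rw [div_eq_mul_one_div ((2 * e + z) ^ 2)]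
    refine mul_le_mul_of_nonneg_left ?_ (sq_nonneg _)
    rw [div_le_div_iff₀ (by positivity) (by positivity)]
    nlinarith [pow_pos hs₀ 2]
  have h3 : (3 * e ^ 2 - 3 * z ^ 2) * (3 / (4 * s₀ ^ 3)) ≤ (2 * e + z) ^ 2 * (3 / (4 * s₀ ^ 3)) := by
    refine mul_le_mul_of_nonneg_right ?_ (by positivity)
    nlinarith [sq_nonneg (e + 2 * z)]
  have h4 : z ^ 2 * (9 / (4 * s₀ ^ 3)) ≤ z / s₀ ^ 2 := by
    rw [← mul_div_assoc, div_le_div_iff₀ (by positivity) (by positivity)]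
    have : 9 * z * (z * s₀ ^ 2) ≤ 4 * s₀ * (z * s₀ ^ 2) :=
      mul_le_mul_of_nonneg_right (by linarith) (by positivity)
    nlinarith
  rw [h1]
  refine le_trans ?_ (add_le_add_right (h3.trans h2) _)
  have e1 : -(2 / s₀ ^ 2) * e + 1 / 2 * (9 / (2 * s₀ ^ 3) * e * e - 4 / s₀ ^ 2 * z) =
      -(2 * e + z) / s₀ ^ 2 + (3 * e ^ 2 - 3 * z ^ 2) * (3 / (4 * s₀ ^ 3)) +
        (z ^ 2 * (9 / (4 * s₀ ^ 3)) - z / s₀ ^ 2) := by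
    field_simp
    ring
  linarith

/-- The function `κ |x - y|⁻²` is strictly infinity subharmonic off `y`, so that its translates do
not touch an infinity superharmonic function from below. -/
lemma IsQuadSuper.not_eventually_barrier_le {u : RN N → ℝ} (h : IsQuadSuper Ω u) {x₁ y : RN N}
    (hx₁ : x₁ ∈ Ω) (hne : x₁ ≠ y) {κ : ℝ} (hκ : 0 < κ) :
    ¬ ∀ᶠ x in 𝓝 x₁, u x₁ + κ * (1 / ‖x - y‖ ^ 2 - 1 / ‖x₁ - y‖ ^ 2) ≤ u x := by
  intro hev
  set w := x₁ - y with hw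
  have hw0 : 0 < ‖w‖ := norm_pos_iff.2 (sub_ne_zero.2 hne)
  set s₀ := ‖w‖ ^ 2 with hs₀
  have hs0 : 0 < s₀ := by positivity
  -- The Hessian at `x₁`, lowered by a multiple of the identity that absorbs the remainder.
  set A : RN N →L[ℝ] RN N := (κ * (9 / (2 * s₀ ^ 3))) • (innerSL ℝ w).smulRight w -
    (κ * (4 / s₀ ^ 2)) • ContinuousLinearMap.id ℝ (RN N) with hAd
  have hA : ∀ v, A v = (κ * (9 / (2 * s₀ ^ 3)) * inner ℝ w v) • w - (κ * (4 / s₀ ^ 2)) • v :=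
    fun v => by simp [hAd, mul_smul]
  set b : RN N := (-(2 * κ / s₀ ^ 2)) • w with hb
  have hsa : ∀ x y, inner ℝ (A x) y = inner ℝ x (A y) := by
    intro x y
    rw [hA, hA, inner_sub_left, inner_sub_right]
    simp only [real_inner_smul_left, real_inner_smul_right]
    rw [real_inner_comm w x]
    ring
  have hq := h x₁ hx₁ b A hsa ?_
  · have : inner ℝ (A b) b = (2 * κ / s₀ ^ 2) ^ 2 * (κ / (2 * s₀)) := by
      rw [hA, hb, inner_sub_left]
      simp only [real_inner_smul_left, real_inner_smul_right, real_inner_self_eq_norm_sq, ← hs₀]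
      field_simp
      ring
    rw [this] at hq
    have : 0 < (2 * κ / s₀ ^ 2) ^ 2 * (κ / (2 * s₀)) := by positivity
    linarith
  · have hsmall : ∀ᶠ x in 𝓝 x₁, ‖x - y‖ ^ 2 < 4 / 3 * s₀ := by
      have hc : Continuous fun x : RN N => ‖x - y‖ ^ 2 := by fun_prop
      refine hc.continuousAt.eventually (gt_mem_nhds ?_)
      change ‖w‖ ^ 2 < _
      rw [← hs₀]
      linarith
    have hsmall2 : ∀ᶠ x in 𝓝 x₁, ‖x - x₁‖ ^ 2 < 4 / 9 * s₀ := by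
      have hc : Continuous fun x : RN N => ‖x - x₁‖ ^ 2 := by fun_prop
      refine hc.continuousAt.eventually (gt_mem_nhds ?_)
      simpa using hs0
    have hneq : ∀ᶠ x in 𝓝 x₁, x ≠ y := isOpen_ne.eventually_mem hne
    filter_upwards [hev, hsmall, hsmall2, hneq] with x hx h1 h2 h3
    refine le_trans ?_ hx
    have hxy : x - y = w + (x - x₁) := by rw [hw]; abel
    have hs : ‖x - y‖ ^ 2 = s₀ + (2 * inner ℝ w (x - x₁) + ‖x - x₁‖ ^ 2) := by
      rw [hxy, norm_add_sq_real]
      ring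
    have hspos : 0 < ‖x - y‖ ^ 2 := by
      have := norm_pos_iff.2 (sub_ne_zero.2 h3)
      positivity
    rw [quadPoly, hb, hA]
    have h4 := inv_sub_inv_barrier hs0 hspos h1 (by positivity) h2 hs
    generalize x - x₁ = t at *
    simp only [inner_sub_left, real_inner_smul_left, real_inner_self_eq_norm_sq]
    have h5 := mul_le_mul_of_nonneg_left h4 hκ.le
    linear_combination h5

/-- Positivity at the centre of a ball spreads to the ball, by comparison with the barrier
`κ (|z - y|⁻² - ρ⁻²)` on an annulus. -/
lemma IsQuadSuper.pos_of_mem_ball {u : RN N → ℝ} (h : IsQuadSuper Ω u) (hΩ : IsOpen Ω)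
    (huc : ContinuousOn u Ω) (hu0 : ∀ x ∈ Ω, 0 ≤ u x) {y : RN N} {ρ : ℝ}
    (hρ : Metric.closedBall y ρ ⊆ Ω) (hy : 0 < u y) {x : RN N} (hx : x ∈ Metric.ball y ρ) :
    0 < u x := by
  have hρ0 : 0 < ρ := dist_nonneg.trans_lt hx
  have hyΩ : y ∈ Ω := hρ (Metric.mem_closedBall_self hρ0.le)
  have hev : ∀ᶠ z in 𝓝 y, u y / 2 < u z :=
    (huc.continuousAt (hΩ.mem_nhds hyΩ)).eventually (lt_mem_nhds (by linarith))
  obtain ⟨η', hη', hball⟩ := Metric.eventually_nhds_iff_ball.1 hev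
  set η := min (η' / 2) (ρ / 2) with hη
  have hη0 : 0 < η := by positivity
  have hηρ : η < ρ := (min_le_right _ _).trans_lt (by linarith)
  have hηu : ∀ z, ‖z - y‖ ≤ η → u y / 2 < u z := fun z hz => hball z (by
    rw [Metric.mem_ball, dist_eq_norm]
    exact (hz.trans (min_le_left _ _)).trans_lt (by linarith))
  set κ := u y / 2 * η ^ 2 with hκ
  have hκ0 : 0 < κ := by positivity
  set g : RN N → ℝ := fun z => κ * (1 / ‖z - y‖ ^ 2 - 1 / ρ ^ 2) with hg
  set K := Metric.closedBall y ρ ∩ {z | η ≤ ‖z - y‖} with hK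
  have hKc : IsCompact K := (isCompact_closedBall y ρ).inter_right
    (isClosed_le continuous_const (by fun_prop))
  have hgc : ContinuousOn g K := by
    refine continuousOn_const.mul (ContinuousOn.sub (continuousOn_const.div (by fun_prop) ?_)
      continuousOn_const)
    intro z hz
    have : 0 < ‖z - y‖ := hη0.trans_le hz.2
    positivity
  by_cases hxη : ‖x - y‖ ≤ η
  · have := hηu x hxη
    linarith
  have hxK : x ∈ K := ⟨Metric.ball_subset_closedBall hx, (not_le.1 hxη).le⟩
  obtain ⟨x₁, hx₁K, hmin⟩ := hKc.exists_isMinOn ⟨x, hxK⟩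
    ((huc.mono (inter_subset_left.trans hρ)).sub hgc)
  have hmin' : ∀ z ∈ K, u x₁ - g x₁ ≤ u z - g z := fun z hz => hmin hz
  have hgx : 0 < g x := by
    have h1 : ‖x - y‖ < ρ := by rw [← dist_eq_norm]; exact hx
    have h2 : 0 < ‖x - y‖ := hη0.trans (not_le.1 hxη)
    refine mul_pos hκ0 (sub_pos.2 ?_)
    exact one_div_lt_one_div_of_lt (by positivity) (pow_lt_pow_left₀ h1 h2.le two_ne_zero)
  suffices 0 ≤ u x₁ - g x₁ by
    have := hmin' x hxK
    linarith
  by_contra! hneg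
  have hx₁Ω : x₁ ∈ Ω := hρ hx₁K.1
  have hx₁η : η < ‖x₁ - y‖ := by
    refine lt_of_le_of_ne hx₁K.2 fun heq => ?_
    have h1 := hηu x₁ heq.ge
    have h2 : g x₁ ≤ u y / 2 := by
      simp only [hg, ← heq, mul_sub]
      have : κ * (1 / η ^ 2) = u y / 2 := by rw [hκ]; field_simp
      rw [this]
      have : 0 ≤ κ * (1 / ρ ^ 2) := by positivity
      linarith
    linarith
  have hx₁ρ : ‖x₁ - y‖ < ρ := by
    have h0 : ‖x₁ - y‖ ≤ ρ := by rw [← dist_eq_norm]; exact hx₁K.1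
    refine lt_of_le_of_ne h0 fun heq => ?_
    have h1 : g x₁ = 0 := by simp only [hg, heq, sub_self, mul_zero]
    have h2 := hu0 x₁ hx₁Ω
    linarith
  refine h.not_eventually_barrier_le hx₁Ω (y := y) (κ := κ) ?_ hκ0 ?_
  · rintro rfl
    rw [sub_self, norm_zero] at hx₁η
    linarith
  · have hc : Continuous fun z : RN N => ‖z - y‖ := by fun_prop
    filter_upwards [hc.continuousAt.eventually (lt_mem_nhds hx₁η),
      hc.continuousAt.eventually (gt_mem_nhds hx₁ρ)] with z hz1 hz2
    have hz := hmin' z ⟨by rw [Metric.mem_closedBall, dist_eq_norm]; exact hz2.le, hz1.le⟩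
    have h3 : κ * (1 / ‖z - y‖ ^ 2 - 1 / ‖x₁ - y‖ ^ 2) = g z - g x₁ := by
      simp only [hg]
      ring
    rw [h3]
    linarith

/-- The strong minimum principle. -/
theorem IsQuadSuper.pos {u : RN N → ℝ} (h : IsQuadSuper Ω u) (hΩ : IsOpen Ω)
    (hΩc : IsPreconnected Ω) (huc : ContinuousOn u Ω) (hu0 : ∀ x ∈ Ω, 0 ≤ u x)
    (hne : ∃ y ∈ Ω, 0 < u y) {x : RN N} (hx : x ∈ Ω) : 0 < u x := by
  obtain ⟨y, hy, huy⟩ := hne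
  set S := Ω ∩ u ⁻¹' Ioi 0 with hS
  have hSo : IsOpen S := huc.isOpen_inter_preimage hΩ isOpen_Ioi
  refine (hΩc.subset_of_closure_inter_subset hSo ⟨y, hy, hy, huy⟩ ?_ hx).2
  rintro z ⟨hzS, hzΩ⟩
  obtain ⟨d, hd, hball⟩ := Metric.isOpen_iff.1 hΩ z hzΩ
  obtain ⟨y', hy', hzy'⟩ := Metric.mem_closure_iff.1 hzS (d / 3) (by positivity)
  refine ⟨hzΩ, h.pos_of_mem_ball hΩ huc hu0 (ρ := d / 2) (fun t ht => hball ?_) hy'.2 ?_⟩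
  · have h1 : dist t y' ≤ d / 2 := ht
    have := dist_triangle_right t z y'
    have h3 := dist_triangle t y' z
    rw [Metric.mem_ball]
    rw [dist_comm] at hzy'
    linarith
  · rw [Metric.mem_ball]
    linarith

/-! ### Compactness -/

/-- The Arzelà–Ascoli theorem for a sequence of continuous functions that is equicontinuous only
in the limit. -/
lemma exists_subseq_tendstoUniformlyOn {X : Type*} [PseudoMetricSpace X] {K : Set X}
    (hK : IsCompact K) {v : ℕ → X → ℝ} (hv : ∀ n, Continuous (v n)) {M : ℝ}
    (hM : ∀ n, ∀ x ∈ K, |v n x| ≤ M)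
    (heq : ∀ ε > 0, ∃ δ > 0, ∀ᶠ n in atTop, ∀ x y, dist x y < δ → |v n x - v n y| < ε) :
    ∃ s : ℕ → ℕ, StrictMono s ∧ ∃ w : X → ℝ,
      TendstoUniformlyOn (fun k => v (s k)) w atTop K := by
  have hKs : CompactSpace K := isCompact_iff_compactSpace.1 hK
  set f : ℕ → BoundedContinuousFunction K ℝ := fun n =>
    BoundedContinuousFunction.mkOfCompact ⟨fun x => v n x, (hv n).comp continuous_subtype_val⟩
  have hcomp : IsCompact (closure (range f)) := by
    refine BoundedContinuousFunction.arzela_ascoli (Metric.closedBall 0 M)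
      (isCompact_closedBall 0 M) _ ?_ ?_
    · rintro _ x ⟨n, rfl⟩
      simpa [f] using hM n x x.2
    · intro x₀
      rw [Metric.equicontinuousAt_iff_right]
      intro ε hε
      obtain ⟨δ, hδ, hn⟩ := heq ε hε
      obtain ⟨n₀, hn₀⟩ := eventually_atTop.1 hn
      have hfin : ∀ᶠ x in 𝓝 x₀, ∀ n ∈ Finset.range n₀, dist (f n x₀) (f n x) < ε := by
        rw [Finset.eventually_all]
        intro n _
        have := (f n).continuous.continuousAt (x := x₀)
        filter_upwards [Metric.tendsto_nhds.1 this ε hε] with x hx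
        rwa [dist_comm]
      filter_upwards [hfin, Metric.ball_mem_nhds x₀ hδ] with x h1 h2
      rintro ⟨_, n, rfl⟩
      rcases lt_or_ge n n₀ with h | h
      · exact h1 n (Finset.mem_range.2 h)
      · rw [Real.dist_eq]
        refine hn₀ n h x₀ x ?_
        rw [dist_comm]
        exact h2
  obtain ⟨g, -, s, hs, hlim⟩ := hcomp.tendsto_subseq fun n => subset_closure (mem_range_self n)
  rw [BoundedContinuousFunction.tendsto_iff_tendstoUniformly] at hlim
  classical
  refine ⟨s, hs, fun x => if hx : x ∈ K then g ⟨x, hx⟩ else 0, ?_⟩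
  rw [tendstoUniformlyOn_iff_tendstoUniformly_comp_coe]
  convert hlim using 1
  · ext k x
    rfl
  · ext x
    simp

end

/-! ### Limits of extremal functions -/

section
variable {N : ℕ} {Ω : Set (RN N)}

lemma linfNorm_congr {u v : RN N → ℝ} (hΩ : MeasurableSet Ω) (h : EqOn u v Ω) :
    linfNorm Ω u = linfNorm Ω v := by
  rw [linfNorm, linfNorm, eLpNorm_congr_ae]
  filter_upwards [ae_restrict_mem hΩ] with x hx using h hx

/-- `v` is the extension by zero of a positive extremal function, and `φ` is a sequence of test
functions converging to it uniformly and in energy. -/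
structure IsExtremalLimit (Ω : Set (RN N)) (p q : ℝ) (v : RN N → ℝ) (φ : ℕ → RN N → ℝ) :
    Prop where
  isTestFunction : ∀ k, IsTestFunction Ω (φ k)
  tendstoUniformly : TendstoUniformly φ v atTop
  continuous : Continuous v
  eq_zero : ∀ x ∉ Ω, v x = 0
  pos : ∀ x ∈ Ω, 0 < v x
  integral_eq_one : ∫ x in Ω, |v x| ^ q = 1
  tendsto_energy :
    Tendsto (fun k => ∫ x in Ω, ‖gradient (φ k) x‖ ^ p) atTop (𝓝 (sobolevConst Ω p q))

lemma IsExtremal.exists_isExtremalLimit {p q : ℝ} {u : RN N → ℝ} (h : IsExtremal Ω p q u)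
    (hΩ : IsOpen Ω) (hΩb : Bornology.IsBounded Ω) (hne : Ω ≠ univ) (hp : (N : ℝ) < p)
    (hp1 : 1 ≤ p) : ∃ v φ, IsExtremalLimit Ω p q v φ ∧ EqOn u v (closure Ω) := by
  obtain ⟨huc, hupos, G, hW, hu1, hG⟩ := h
  obtain ⟨v, φ, hφ, hφv, hvc, hv0, hvu, hI⟩ :=
    hW.exists_continuous_rep hΩb hp hp1 ((ne_univ_iff_exists_notMem _).1 hne)
  have heq : EqOn v u Ω :=
    Measure.eqOn_open_of_ae_eq hvu hΩ hvc.continuousOn (huc.mono subset_closure)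
  refine ⟨v, φ, ⟨hφ, hφv, hvc, hv0, fun x hx => by rw [heq hx]; exact hupos x hx, ?_, hG ▸ hI⟩,
    (heq.symm).of_subset_closure huc hvc.continuousOn subset_closure subset_rfl⟩
  rw [← hu1]
  refine integral_congr_ae ?_
  filter_upwards [hvu] with x hx
  rw [hx]

lemma IsExtremalLimit.abs_sub_le {p q : ℝ} {v : RN N → ℝ} {φ : ℕ → RN N → ℝ}
    (h : IsExtremalLimit Ω p q v φ) (hp : (N : ℝ) < p) (hp1 : 1 ≤ p) {ε : ℝ} (hε : 0 < ε)
    (x a : RN N) : |v x - v a| ≤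
      morreyConst N p ε * (dist x a + 2 * ε) * sobolevConst Ω p q ^ (1 / p) :=
  abs_sub_le_of_tendstoUniformly h.isTestFunction h.tendstoUniformly hp hp1 h.tendsto_energy hε x a

/-- The supremum norms of extremal functions tend to `1`: the `L^q` normalisation gives the lower
bound and the Morrey estimate the upper one. -/
theorem tendsto_linfNorm_of_isExtremalLimit (hΩ : IsOpen Ω) (hΩn : Ω.Nonempty)
    (hΩb : Bornology.IsBounded Ω) (hne : Ω ≠ univ) {q : ℝ → ℝ} (hq : Tendsto q atTop atTop)
    {v : ℝ → RN N → ℝ} {φ : ℝ → ℕ → RN N → ℝ}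
    (h : ∀ᶠ p in atTop, IsExtremalLimit Ω p (q p) (v p) (φ p)) :
    Tendsto (fun p => linfNorm Ω (v p)) atTop (𝓝 1) := by
  have hR := (exists_bdryDist_eq_linfNorm hΩ hΩn hΩb hne).1
  have hlim := tendsto_sobolevConst_rpow hΩ hΩn hΩb hne hq
  set R := linfNorm Ω (bdryDist Ω) with hRdef
  have hvol0 : 0 < (volume Ω).toReal :=
    ENNReal.toReal_pos (hΩ.measure_pos _ hΩn).ne' hΩb.measure_lt_top.ne
  have hpq : ∀ᶠ p : ℝ in atTop, (N : ℝ) < p ∧ 1 ≤ p ∧ 0 < q p :=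
    (eventually_gt_atTop _).and ((eventually_ge_atTop _).and (hq.eventually_gt_atTop 0))
  rw [tendsto_order]
  constructor
  · intro a ha
    have hl := tendsto_rpow_one_div hq hvol0
    have hl' : Tendsto (fun p => a * (volume Ω).toReal ^ (1 / q p)) atTop (𝓝 (a * 1)) :=
      hl.const_mul a
    filter_upwards [h, hpq, hl'.eventually (gt_mem_nhds (by simpa using ha))] with p hp hpp hpa
    obtain ⟨M, hM⟩ := hΩb.isCompact_closure.exists_bound_of_continuousOn hp.continuous.continuousOn
    have h1 := one_le_mul_volume_rpow hΩ hΩb hpp.2.2 hp.integral_eq_one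
      (ENNReal.toReal_nonneg : 0 ≤ linfNorm Ω (v p))
      fun x hx => norm_le_linfNorm hΩ hp.continuous.continuousOn
        (fun y hy => hM y (subset_closure hy)) hx
    exact lt_of_mul_lt_mul_right (hpa.trans_le h1) (by positivity)
  · intro a ha
    obtain ⟨ε, hε, hεa⟩ : ∃ ε > 0, (R + 2 * ε) * R⁻¹ < a := by
      have hc : ContinuousAt (fun ε : ℝ => (R + 2 * ε) * R⁻¹) 0 := by fun_prop
      have : ∀ᶠ ε in 𝓝 (0 : ℝ), (R + 2 * ε) * R⁻¹ < a :=
        hc.eventually (gt_mem_nhds (by simpa [hR.ne'] using ha))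
      obtain ⟨ε, h1, h2⟩ := ((this.filter_mono nhdsWithin_le_nhds).and
        (self_mem_nhdsWithin : Ioi (0 : ℝ) ∈ 𝓝[>] 0)).exists
      exact ⟨ε, h2, h1⟩
    have hl : Tendsto (fun p => morreyConst N p ε * (R + 2 * ε) *
        sobolevConst Ω p (q p) ^ (1 / p)) atTop (𝓝 (1 * (R + 2 * ε) * R⁻¹)) :=
      ((tendsto_morreyConst N hε).mul tendsto_const_nhds).mul hlim
    filter_upwards [h, hpq, hl.eventually (gt_mem_nhds (by simpa using hεa))] with p hp hpp hpa
    refine lt_of_le_of_lt ?_ hpa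
    have hC := morreyConst_pos (N := N) hpp.1 hε
    have hS : 0 ≤ sobolevConst Ω p (q p) ^ (1 / p) := Real.rpow_nonneg sobolevConst_nonneg _
    exact linfNorm_le hΩ.measurableSet (by positivity) fun x _ =>
      abs_le_of_morrey hΩ hΩn hΩb hne hp.eq_zero hC.le hS hε.le
        (fun x a => hp.abs_sub_le hpp.1 hpp.2.1 hε x a) x

/-- Extremal functions subconverge uniformly to a Lipschitz function that is infinity superharmonic
in the sense of quadratic polynomials. -/
theorem exists_subseq_limit_of_isExtremalLimit (hΩ : IsOpen Ω) (hΩn : Ω.Nonempty)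
    (hΩb : Bornology.IsBounded Ω) (hne : Ω ≠ univ) {q : ℝ → ℝ} (hq : Tendsto q atTop atTop)
    {v : ℝ → RN N → ℝ} {φ : ℝ → ℕ → RN N → ℝ}
    (h : ∀ᶠ p in atTop, IsExtremalLimit Ω p (q p) (v p) (φ p))
    {pn : ℕ → ℝ} (hpn : Tendsto pn atTop atTop) :
    ∃ s : ℕ → ℕ, StrictMono s ∧ ∃ w : RN N → ℝ,
      TendstoUniformly (fun k => v (pn (s k))) w atTop ∧ (∀ x ∉ Ω, w x = 0) ∧
      (∀ x, 0 ≤ w x) ∧ (∀ x a, |w x - w a| ≤ (linfNorm Ω (bdryDist Ω))⁻¹ * dist x a) ∧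
      IsQuadSuper Ω w := by
  have hR := (exists_bdryDist_eq_linfNorm hΩ hΩn hΩb hne).1
  have hlim := tendsto_sobolevConst_rpow hΩ hΩn hΩb hne hq
  set R := linfNorm Ω (bdryDist Ω) with hRdef
  have hgood : ∀ᶠ p : ℝ in atTop, IsExtremalLimit Ω p (q p) (v p) (φ p) ∧ (N : ℝ) < p ∧
      1 ≤ p ∧ 3 < p ∧ 0 < q p ∧
      morreyConst N p 1 * (R + 2 * 1) * sobolevConst Ω p (q p) ^ (1 / p) <
        1 * (R + 2 * 1) * R⁻¹ + 1 := by
    refine h.and ((eventually_gt_atTop _).and ((eventually_ge_atTop _).and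
      ((eventually_gt_atTop _).and ((hq.eventually_gt_atTop 0).and ?_))))
    exact (((tendsto_morreyConst N one_pos).mul tendsto_const_nhds).mul hlim).eventually
      (gt_mem_nhds (lt_add_one _))
  obtain ⟨n₀, hn₀⟩ := eventually_atTop.1 (hpn.eventually hgood)
  -- Discarding finitely many terms, all members of the sequence satisfy the estimates.
  set P : ℕ → ℝ := fun n => pn (n + n₀) with hP
  have hPt : Tendsto P atTop atTop := hpn.comp (tendsto_add_atTop_nat n₀)
  have hPg := fun n => hn₀ (n + n₀) (Nat.le_add_left _ _)
  have hmor : ∀ n (ε : ℝ), 0 < ε → ∀ x a, |v (P n) x - v (P n) a| ≤ morreyConst N (P n) ε *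
      (dist x a + 2 * ε) * sobolevConst Ω (P n) (q (P n)) ^ (1 / P n) := fun n ε hε x a =>
    (hPg n).1.abs_sub_le (hPg n).2.1 (hPg n).2.2.1 hε x a
  have hbound : ∀ n x, |v (P n) x| ≤ 1 * (R + 2 * 1) * R⁻¹ + 1 := by
    intro n x
    obtain ⟨h1, h2, h3, -, -, h6⟩ := hPg n
    refine le_trans ?_ h6.le
    exact abs_le_of_morrey hΩ hΩn hΩb hne h1.eq_zero (morreyConst_pos h2 one_pos).le
      (Real.rpow_nonneg sobolevConst_nonneg _) zero_le_one (hmor n 1 one_pos) x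
  have hequi : ∀ ε > 0, ∃ δ > 0, ∀ᶠ n in atTop, ∀ x y, dist x y < δ →
      |v (P n) x - v (P n) y| < ε := by
    intro ε hε
    have hδ : 0 < ε * R / 4 := by positivity
    refine ⟨ε * R / 4, hδ, ?_⟩
    have hl : Tendsto (fun p => morreyConst N p (ε * R / 4) * (ε * R / 4 + 2 * (ε * R / 4)) *
        sobolevConst Ω p (q p) ^ (1 / p)) atTop
          (𝓝 (1 * (ε * R / 4 + 2 * (ε * R / 4)) * R⁻¹)) :=
      ((tendsto_morreyConst N hδ).mul tendsto_const_nhds).mul hlim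
    have hlt : 1 * (ε * R / 4 + 2 * (ε * R / 4)) * R⁻¹ < ε := by
      field_simp
      linarith
    filter_upwards [(hl.comp hPt).eventually (gt_mem_nhds hlt)] with n hn x y hxy
    refine lt_of_le_of_lt ((hmor n _ hδ x y).trans ?_) hn
    have hC := morreyConst_pos (N := N) (hPg n).2.1 hδ
    have hS : 0 ≤ sobolevConst Ω (P n) (q (P n)) ^ (1 / P n) :=
      Real.rpow_nonneg sobolevConst_nonneg _
    simp only [Function.comp_apply]
    gcongr
  obtain ⟨s, hs, w₀, hw₀⟩ := exists_subseq_tendstoUniformlyOn hΩb.isCompact_closure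
    (fun n => (hPg n).1.continuous) (fun n x _ => hbound n x) hequi
  set w : RN N → ℝ := Ω.indicator w₀ with hw
  have hunif : TendstoUniformly (fun k => v (P (s k))) w atTop := by
    rw [Metric.tendstoUniformly_iff]
    intro ε hε
    filter_upwards [Metric.tendstoUniformlyOn_iff.1 hw₀ ε hε] with k hk x
    by_cases hx : x ∈ Ω
    · rw [hw, indicator_of_mem hx]
      exact hk x (subset_closure hx)
    · rw [hw, indicator_of_notMem hx, (hPg (s k)).1.eq_zero x hx, dist_self]
      exact hε
  have hPs : Tendsto (fun k => P (s k)) atTop atTop := hPt.comp hs.tendsto_atTop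
  refine ⟨fun k => s k + n₀, fun a b hab => Nat.add_lt_add_right (hs hab) n₀, w, hunif,
    fun x hx => indicator_of_notMem hx _, fun x => ?_, fun x a => ?_, ?_⟩
  · refine ge_of_tendsto' (hunif.tendsto_at x) fun k => ?_
    by_cases hx : x ∈ Ω
    · exact ((hPg (s k)).1.pos x hx).le
    · exact ((hPg (s k)).1.eq_zero x hx).ge
  · have hε : ∀ ε > 0, |w x - w a| ≤ 1 * (dist x a + 2 * ε) * R⁻¹ := fun ε hε => by
      have hl : Tendsto (fun p => morreyConst N p ε * (dist x a + 2 * ε) *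
          sobolevConst Ω p (q p) ^ (1 / p)) atTop (𝓝 (1 * (dist x a + 2 * ε) * R⁻¹)) :=
        ((tendsto_morreyConst N hε).mul tendsto_const_nhds).mul hlim
      exact le_of_tendsto_of_tendsto' ((hunif.tendsto_at x).sub (hunif.tendsto_at a)).abs
        (hl.comp hPs) fun k => hmor (s k) ε hε x a
    have hlim0 : Tendsto (fun ε : ℝ => 1 * (dist x a + 2 * ε) * R⁻¹) (𝓝[>] 0)
        (𝓝 (1 * (dist x a + 2 * 0) * R⁻¹)) :=
      (Continuous.tendsto (by fun_prop) _).mono_left nhdsWithin_le_nhds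
    have := ge_of_tendsto hlim0 (by filter_upwards [self_mem_nhdsWithin] with ε h using hε ε h)
    linarith
  · refine isQuadSuper_of_tendstoUniformly hΩ hPs hunif (.of_forall fun k => ?_)
    obtain ⟨h1, -, -, h4, h5, -⟩ := hPg (s k)
    intro ψ hψ x₀ r m hr hrΩ hm hlt hx₀ hdiv
    exact false_of_touching_below hΩ hΩb h1.isTestFunction h1.tendstoUniformly h1.continuous
      (fun x hx => (h1.pos x hx).le) h4 h5 h1.integral_eq_one h1.tendsto_energy hψ hr hrΩ hm hlt
      hx₀ hdiv

end

end SobolevExtremal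

open SobolevExtremal
theorem theorem1 {N : ℕ} (hN : 2 ≤ N) (Ω : Set (RN N)) (hΩo : IsOpen Ω) (hΩc : IsConnected Ω)
    (hΩb : Bornology.IsBounded Ω) (q : ℝ → ℝ) (hq1 : ∀ p : ℝ, (N : ℝ) < p → 1 ≤ q p)
    (hq : Tendsto q atTop atTop) :
    lambdaInf Ω = (linfNorm Ω (bdryDist Ω))⁻¹ ∧
    Tendsto (fun p : ℝ => sobolevConst Ω p (q p) ^ (1 / p)) atTop (𝓝 (lambdaInf Ω)) ∧
    ∀ u : ℝ → RN N → ℝ, (∀ p : ℝ, (N : ℝ) < p → IsExtremal Ω p (q p) (u p)) →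
      Tendsto (fun p : ℝ => linfNorm Ω (u p)) atTop (𝓝 1) ∧
      ∀ pn : ℕ → ℝ, Tendsto pn atTop atTop →
        ∃ s : ℕ → ℕ, StrictMono s ∧ ∃ uInf : RN N → ℝ,
          TendstoUniformlyOn (fun k => u (pn (s k))) uInf atTop (closure Ω) ∧
          MemC0 Ω uInf ∧
          (∀ x ∈ closure Ω, 0 ≤ uInf x ∧ uInf x ≤ lambdaInf Ω * bdryDist Ω x) ∧
          linfNorm Ω uInf = 1 ∧
          (∃ G : RN N → RN N, MemW1Inf Ω uInf G ∧ linfNorm Ω G = lambdaInf Ω) ∧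
          {x ∈ Ω | uInf x = 1} ⊆ {x ∈ Ω | bdryDist Ω x = linfNorm Ω (bdryDist Ω)} ∧
          IsInfSuperharmonic Ω uInf ∧
          ∀ x ∈ Ω, 0 < uInf x := by
  have hne : Ω ≠ univ := ne_univ_of_isBounded (by omega) hΩb
  have hΩn := hΩc.nonempty
  obtain ⟨hR, hle, -⟩ := exists_bdryDist_eq_linfNorm hΩo hΩn hΩb hne
  have hΛ := lambdaInf_eq hΩo hΩn hΩb hne
  refine ⟨hΛ, hΛ ▸ tendsto_sobolevConst_rpow hΩo hΩn hΩb hne hq, fun u hu => ?_⟩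
  have hex : ∀ p : ℝ, ∃ v φ, (N : ℝ) < p →
      IsExtremalLimit Ω p (q p) v φ ∧ EqOn (u p) v (closure Ω) := by
    intro p
    by_cases hp : (N : ℝ) < p
    · have hp1 : 1 ≤ p := by
        have : (2 : ℝ) ≤ N := by exact_mod_cast hN
        linarith
      obtain ⟨v, φ, h⟩ := (hu p hp).exists_isExtremalLimit hΩo hΩb hne hp hp1
      exact ⟨v, φ, fun _ => h⟩
    · exact ⟨0, 0, fun h => absurd h hp⟩
  choose v φ hvφ using hex
  have hlim : ∀ᶠ p in atTop, IsExtremalLimit Ω p (q p) (v p) (φ p) := by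
    filter_upwards [eventually_gt_atTop (N : ℝ)] with p hp using (hvφ p hp).1
  have hequ : ∀ᶠ p in atTop, EqOn (u p) (v p) (closure Ω) := by
    filter_upwards [eventually_gt_atTop (N : ℝ)] with p hp using (hvφ p hp).2
  have hnorm := tendsto_linfNorm_of_isExtremalLimit hΩo hΩn hΩb hne hq hlim
  refine ⟨hnorm.congr' ?_, fun pn hpn => ?_⟩
  · filter_upwards [hequ] with p hp
    exact (linfNorm_congr hΩo.measurableSet (hp.mono subset_closure)).symm
  obtain ⟨s, hs, w, hw, hw0, hwnn, hwL, hwq⟩ :=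
    exists_subseq_limit_of_isExtremalLimit hΩo hΩn hΩb hne hq hlim hpn
  set R := linfNorm Ω (bdryDist Ω) with hRdef
  have hps : Tendsto (fun k => pn (s k)) atTop atTop := hpn.comp hs.tendsto_atTop
  have hwLip : LipschitzWith ⟨R⁻¹, by positivity⟩ w :=
    LipschitzWith.of_dist_le_mul fun x y => by rw [Real.dist_eq]; exact hwL x y
  have hwd : ∀ x, w x ≤ R⁻¹ * Metric.infDist x Ωᶜ := by
    intro x
    by_cases hx : x ∈ Ω
    · obtain ⟨y, hy, hxy⟩ := exists_mem_frontier_infDist_compl_eq_dist hx hne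
      rw [hΩo.frontier_eq] at hy
      have := hwL x y
      rw [hw0 y hy.2, sub_zero, ← hxy] at this
      exact (le_abs_self _).trans this
    · rw [hw0 x hx, Metric.infDist_zero_of_mem hx, mul_zero]
  have hw1 : ∀ x ∈ Ω, ‖w x‖ ≤ 1 := fun x _ => by
    rw [Real.norm_of_nonneg (hwnn x)]
    refine (hwd x).trans ?_
    rw [inv_mul_le_one₀ hR]
    exact hle x
  have hC0 : MemC0 Ω w := ⟨hwLip.continuous.continuousOn, fun x hx => by
    rw [hΩo.frontier_eq] at hx
    exact hw0 x hx.2⟩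
  have hwnorm : linfNorm Ω w = 1 := by
    refine le_antisymm (linfNorm_le hΩo.measurableSet zero_le_one hw1) ?_
    have hL0 : 0 ≤ linfNorm Ω w := ENNReal.toReal_nonneg
    refine le_of_forall_pos_le_add fun ε hε => ?_
    refine le_of_tendsto (hnorm.comp hps) ?_
    filter_upwards [Metric.tendstoUniformly_iff.1 hw ε hε] with k hk
    refine linfNorm_le hΩo.measurableSet (by positivity) fun x hx => ?_
    have h1 := norm_le_linfNorm hΩo hwLip.continuous.continuousOn hw1 hx
    have h2 : ‖v (pn (s k)) x - w x‖ < ε := by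
      rw [← dist_eq_norm, dist_comm]
      exact hk x
    have h3 := norm_add_le (w x) (v (pn (s k)) x - w x)
    rw [add_sub_cancel] at h3
    linarith
  have hW := memW1Inf_of_lipschitzWith hwLip hΩo hΩb
  refine ⟨s, hs, w, ?_, hC0, fun x hx => ⟨hwnn x, ?_⟩, hwnorm, ⟨gradient w, hW, ?_⟩,
    fun x hx => ⟨hx.1, ?_⟩, hwq.isInfSuperharmonic hwLip.continuous.continuousOn, fun x hx => ?_⟩
  · refine (hw.tendstoUniformlyOn (s := closure Ω)).congr ?_
    filter_upwards [hps.eventually hequ] with k hk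
    exact hk.symm
  · rw [hΛ, ← infDist_compl_eq_bdryDist hΩo hne hx]
    exact hwd x
  · refine le_antisymm ?_ ?_
    · rw [hΛ]
      exact linfNorm_le hΩo.measurableSet (by positivity)
        fun x _ => norm_gradient_le_of_lipschitz hwLip x
    · refine csInf_le ⟨0, ?_⟩ ⟨w, gradient w, hC0, hW, hwnorm, rfl⟩
      rintro r ⟨-, G, -, -, -, rfl⟩
      exact ENNReal.toReal_nonneg
  · have h1 := hwd x
    have hx1 : w x = 1 := hx.2
    rw [hx1, ← div_eq_inv_mul, one_le_div hR] at h1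
    rw [← infDist_compl_eq_bdryDist hΩo hne (subset_closure hx.1)]
    exact le_antisymm (hle x) h1
  · refine hwq.pos hΩo hΩc.isPreconnected hwLip.continuous.continuousOn (fun x _ => hwnn x) ?_ hx
    by_contra! hall
    have : linfNorm Ω w ≤ 0 := linfNorm_le hΩo.measurableSet le_rfl fun x hx => by
      rw [Real.norm_of_nonneg (hwnn x)]
      exact hall x hx
    linarith
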